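/- Let $p_k$ denote the $k$-th prime number ($p_1=2$). For a Dirichlet series $\sum_{n\ge1}a_nn^{-s}$ let $\sigma_a$, $\sigma_b$, $\sigma_c\in[-\infty,\infty]$ be the infimum of the real $\sigma$ such that, on the half plane $\{\operatorname{Re}s>\sigma\}$, the series converges absolutely, converges to a bounded function, respectively converges (partial sums $\sum_{n\le N}a_nn^{-s}$ as $N\to\infty$). Let $\Lambda(n)$ be the number of prime factors of $n$ counted with multiplicity. Let $(\beta_L)_{L\ge1}$ be any complex numbers with $|\beta_L|=1$ (for example $\beta_L=1$ for all $L$). Define $$a_n=\beta_L\,2^{-3L/2}\,e^{2\pi i\,i_1i_2/2^L}\quad\text{if } n=p_{2\cdot2^L+i_1}\,p_{3\cdot 2^L+i_2}\text{ with } L\ge1,\ 0\le i_1,i_2<2^L,$$ and $a_n=0$ for all other $n$. These $a_n$ are well defined, and $\Lambda(n)=2$ whenever $a_n\ne0$, so the series $\sum a_nn^{-s}$ has homogeneity $2$. It satisfies $$\sigma_b=0,\qquad \sigma_a\ge\tfrac14,\qquad \sigma_c\le-\tfrac14,$$ and moreover $$\sigma_a-\sigma_b=\tfrac14,\qquad \sigma_b-\sigma_c\ge\tfrac14,$$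 so the series converges beyond its Bohr strip. The value $\frac14$ is optimal: every Dirichlet series $\sum a_nn^{-s}$ with $a_n=0$ whenever $\Lambda(n)>2$ satisfies $\sigma_a\le\sigma_b+\frac14$. -/

import Mathlib

open Filter Topology
open scoped ArithmeticFunction.Omega

/-- The ordinary Dirichlet series `∑_{n ≥ 1} a n * n ^ (-s)` converges (possibly only
conditionally, in the natural order of summation) to the value `l` at the point `s`. -/
def DirichletConvergesTo (a : ℕ → ℂ) (s l : ℂ) : Prop :=
  Tendsto (fun N : ℕ => ∑ n ∈ Finset.Icc 1 N, a n * (n : ℂ) ^ (-s)) atTop (𝓝 l)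

/-- The abscissa of convergence `σ_c`: the infimum of the real `σ` such that the series converges
at every `s` with `Re s > σ`. -/
noncomputable def abscissaOfConv (a : ℕ → ℂ) : EReal :=
  sInf (Real.toEReal '' {σ : ℝ | ∀ s : ℂ, σ < s.re → ∃ l : ℂ, DirichletConvergesTo a s l})

/-- The abscissa of boundedness `σ_b`: the infimum of the real `σ` such that the series converges
to a bounded function on the half plane `Re s > σ`. -/
noncomputable def abscissaOfBoundedness (a : ℕ → ℂ) : EReal :=
  sInf (Real.toEReal ''
    {σ : ℝ | ∃ C : ℝ, ∀ s : ℂ, σ < s.re → ∃ l : ℂ, DirichletConvergesTo a s l ∧ ‖l‖ ≤ C})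

/-- The `k`-th prime number for `k ≥ 1`, so that `kthPrime 1 = 2`, `kthPrime 2 = 3`. -/
noncomputable def kthPrime (k : ℕ) : ℕ := Nat.nth Nat.Prime (k - 1)

/-- The entry `ω ^ (i j)`, `ω = exp (2 π i / r)`, of the `r × r` Walsh matrix. -/
noncomputable def walshEntry (r i j : ℕ) : ℂ :=
  Complex.exp (2 * Real.pi * Complex.I / r) ^ (i * j)

/-- The integer `n = p_k p_k'` with `k = 2 * 2 ^ L + i` and `k' = 3 * 2 ^ L + j`. -/
noncomputable def blockProduct (L i j : ℕ) : ℕ :=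
  kthPrime (2 * 2 ^ L + i) * kthPrime (3 * 2 ^ L + j)

/-- The coefficients of the `2`-homogeneous Walsh series with unimodular weights `β`: for
`L ≥ 1` and `i, j < 2 ^ L`, the coefficient at `n = blockProduct L i j` is
`β L * 2 ^ (- 3 L / 2) * ω ^ (i j)` with `ω = exp (2 π i / 2 ^ L)`; all others are `0`.
A given `n` is `blockProduct L i j` for at most one triple `(L, i, j)`, and then `L ≤ n`, so the
sum below has at most one nonzero term. -/
noncomputable def walshCoeff (β : ℕ → ℂ) (n : ℕ) : ℂ :=
  ∑ L ∈ Finset.Icc 1 n, ∑ i ∈ Finset.range (2 ^ L), ∑ j ∈ Finset.range (2 ^ L),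
    if n = blockProduct L i j then
      β L * (((2 : ℝ) ^ (-(3 / 2 : ℝ) * (L : ℝ)) : ℝ) : ℂ) * walshEntry (2 ^ L) i j
    else 0

/-!
Optimality of `1/4`. A series bounded on a half plane containing the imaginary axis recovers its
coefficients there as means of `f (i t) n ^ (i t)`. Averaging against a Riesz product over the
primes, which is nonnegative of mean one, keeps the bound, so `∑_A (∏_{p ∈ A} λ_p) b (∏_{p ∈ A} p)`
is bounded for all small complex `λ`. For a polynomial of degree two, polarization and Khinchine's
inequality then bound the mixed Littlewood sum `∑_q (∑_p |b (p q)| ^ 2) ^ (1/2)`. By Cauchy–Schwarz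
over `p < q` and `∑_{p ≤ q} p ^ (-1/2) ≤ 2 q ^ (1/2)`, the weight `(p q) ^ (-1/4)` is exactly what
turns this into absolute convergence.

The Walsh series. The Walsh matrix of size `r = 2 ^ L` has orthogonal rows of norm `r ^ (1/2)`, so
its bilinear form is at most `r ^ (3/2)` on vectors with entries in the unit disc, and the factor
`r ^ (-3/2)` bounds each block on the imaginary axis. The condition `n ≤ N` cuts a block along a
staircase; each row is then a geometric sum, and these add up to `O(r log r)` only, that is to
`r ^ (-1/2 + ε)` after normalization. In absolute value, on the other hand, a block sums to
`r ^ (1/2)` up to the factor `n ^ (-y)`. By Chebyshev's bound the indices `n` of the block have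
size `r ^ (2 + o(1))`, so the first estimate is `N ^ (-1/4 + ε)`, giving `σ_c ≤ -1/4`, and the
second diverges for `y < 1/4`.
-/

section Abel

lemma sum_Icc_by_parts (R g : ℕ → ℂ) (N : ℕ) :
    ∑ n ∈ Finset.Icc 1 (N + 1), (R (n - 1) - R n) * g n =
      R 0 * g 1 - R (N + 1) * g (N + 1) +
        ∑ n ∈ Finset.range N, R (n + 1) * (g (n + 2) - g (n + 1)) := by
  induction N with
  | zero => simp [sub_mul]
  | succ N ih =>
    rw [Finset.sum_Icc_succ_top (by omega), ih, Finset.sum_range_succ]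
    simp only [Nat.add_sub_cancel]
    ring

lemma norm_natCast_cpow_sub_le {s : ℂ} (hs : -1 ≤ s.re) {n : ℕ} (hn : 1 ≤ n) :
    ‖((n + 1 : ℕ) : ℂ) ^ (-s) - (n : ℂ) ^ (-s)‖ ≤ ‖s‖ * (n : ℝ) ^ (-s.re - 1) := by
  obtain rfl | h0 := eq_or_ne s 0
  · simp
  have hn' : (0 : ℝ) < n := by exact_mod_cast hn
  have hpos : ∀ x ∈ Set.Icc (n : ℝ) (n + 1), 0 < x := fun x hx => hn'.trans_le hx.1
  have hbound : ∀ x ∈ Set.Icc (n : ℝ) (n + 1),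
      ‖-s * (x : ℂ) ^ (-s - 1)‖ ≤ ‖s‖ * (n : ℝ) ^ (-s.re - 1) := fun x hx => by
    rw [norm_mul, norm_neg, Complex.norm_cpow_eq_rpow_re_of_pos (hpos x hx)]
    gcongr
    exact Real.rpow_le_rpow_of_nonpos hn' hx.1 (by simp; linarith)
  simpa using (convex_Icc (n : ℝ) (n + 1)).norm_image_sub_le_of_norm_hasDerivWithin_le (𝕜 := ℝ)
    (x := n) (y := n + 1) (fun x hx => (hasDerivAt_ofReal_cpow_const (hpos x hx).ne'
      (neg_ne_zero.2 h0)).hasDerivWithinAt) hbound (by simp) (by simp)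

/-- The `n`-th term of the series obtained by summation by parts from a Dirichlet series whose
coefficients are the differences `R (n - 1) - R n`. -/
noncomputable def abelTerm (R : ℕ → ℂ) (n : ℕ) (s : ℂ) : ℂ :=
  R (n + 1) * (((n + 2 : ℕ) : ℂ) ^ (-s) - ((n + 1 : ℕ) : ℂ) ^ (-s))

lemma norm_abelTerm_le {R : ℕ → ℂ} {C θ δ : ℝ} (hR : ∀ n, 1 ≤ n → ‖R n‖ ≤ C * (n : ℝ) ^ (-θ))
    {s : ℂ} (hs : -1 ≤ s.re) (hδ : -θ + δ ≤ s.re) (n : ℕ) :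
    ‖abelTerm R n s‖ ≤ C * ‖s‖ * ((n + 1 : ℕ) : ℝ) ^ (-(1 + δ)) := by
  have hC : 0 ≤ C := by simpa using (norm_nonneg _).trans (hR 1 le_rfl)
  calc ‖abelTerm R n s‖
      ≤ (C * ((n + 1 : ℕ) : ℝ) ^ (-θ)) * (‖s‖ * ((n + 1 : ℕ) : ℝ) ^ (-s.re - 1)) := by
        rw [abelTerm, norm_mul]
        gcongr
        · exact hR _ (by omega)
        · exact norm_natCast_cpow_sub_le hs (by omega)
    _ = C * ‖s‖ * ((n + 1 : ℕ) : ℝ) ^ (-θ + (-s.re - 1)) := by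
        rw [Real.rpow_add (by positivity)]
        ring
    _ ≤ _ := by
        gcongr
        · exact_mod_cast Nat.succ_pos n
        · linarith

lemma summable_natCast_succ_rpow {δ : ℝ} (hδ : 0 < δ) :
    Summable fun n : ℕ => ((n + 1 : ℕ) : ℝ) ^ (-(1 + δ)) :=
  (summable_nat_add_iff 1).2 (Real.summable_nat_rpow.2 (by linarith))

variable {a R : ℕ → ℂ} {C θ : ℝ}

lemma differentiableOn_tsum_abelTerm (hR : ∀ n, 1 ≤ n → ‖R n‖ ≤ C * (n : ℝ) ^ (-θ)) (hθ : θ ≤ 1) :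
    DifferentiableOn ℂ (fun s => ∑' n, abelTerm R n s) {s | -θ < s.re} := by
  intro s₀ (hs₀ : -θ < s₀.re)
  have hC : 0 ≤ C := by simpa using (norm_nonneg _).trans (hR 1 le_rfl)
  obtain ⟨δ, hδ, hδs⟩ : ∃ δ > 0, -θ + δ < s₀.re := ⟨(s₀.re + θ) / 2, by linarith, by linarith⟩
  set U : Set ℂ := {s | -θ + δ < s.re} ∩ {s | ‖s‖ < ‖s₀‖ + 1}
  have hU : IsOpen U := (isOpen_lt continuous_const Complex.continuous_re).inter
    (isOpen_lt continuous_norm continuous_const)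
  have hbound : ∀ n, ∀ s ∈ U,
      ‖abelTerm R n s‖ ≤ C * (‖s₀‖ + 1) * ((n + 1 : ℕ) : ℝ) ^ (-(1 + δ)) := by
    rintro n s ⟨hs, hs'⟩
    rw [Set.mem_ofPred_eq] at hs hs'
    refine (norm_abelTerm_le hR (by linarith) hs.le n).trans ?_
    gcongr
  have hdiff : ∀ n, DifferentiableOn ℂ (abelTerm R n) U := fun n => by
    have hcpow : ∀ k : ℕ, Differentiable ℂ fun s : ℂ => ((k + 1 : ℕ) : ℂ) ^ (-s) := fun k =>
      differentiable_neg.const_cpow (Or.inl (by exact_mod_cast Nat.succ_ne_zero k))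
    exact (((hcpow (n + 1)).sub (hcpow n)).const_mul _).differentiableOn
  exact ((Complex.differentiableOn_tsum_of_summable_norm
    ((summable_natCast_succ_rpow hδ).mul_left _) hdiff hU hbound).differentiableAt
    (hU.mem_nhds ⟨hδs, by simp⟩)).differentiableWithinAt

lemma tendsto_mul_natCast_cpow_neg (hR : ∀ n, 1 ≤ n → ‖R n‖ ≤ C * (n : ℝ) ^ (-θ)) {s : ℂ}
    (hs : -θ < s.re) : Tendsto (fun n : ℕ => R n * (n : ℂ) ^ (-s)) atTop (𝓝 0) := by
  have hlim : Tendsto (fun n : ℕ => C * (n : ℝ) ^ (-(θ + s.re))) atTop (𝓝 (C * 0)) :=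
    ((tendsto_rpow_neg_atTop (by linarith)).comp tendsto_natCast_atTop_atTop).const_mul _
  rw [mul_zero] at hlim
  refine squeeze_zero_norm' ?_ hlim
  filter_upwards [eventually_ge_atTop 1] with n hn
  rw [norm_mul, Complex.norm_natCast_cpow_of_pos hn, Complex.neg_re, neg_add,
    Real.rpow_add (by exact_mod_cast hn), ← mul_assoc]
  gcongr
  exact hR n hn

theorem dirichletConvergesTo_abel (ha : ∀ n, 1 ≤ n → a n = R (n - 1) - R n)
    (hR : ∀ n, 1 ≤ n → ‖R n‖ ≤ C * (n : ℝ) ^ (-θ)) (hθ : θ ≤ 1) {s : ℂ} (hs : -θ < s.re) :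
    DirichletConvergesTo a s (R 0 + ∑' n, abelTerm R n s) := by
  have hsum : Summable fun n => abelTerm R n s :=
    .of_norm_bounded ((summable_natCast_succ_rpow (δ := s.re + θ) (by linarith)).mul_left _)
      (norm_abelTerm_le hR (by linarith) (by linarith))
  have hparts : ∀ N : ℕ, ∑ n ∈ Finset.Icc 1 (N + 1), a n * (n : ℂ) ^ (-s) =
      R 0 - R (N + 1) * ((N + 1 : ℕ) : ℂ) ^ (-s) + ∑ n ∈ Finset.range N, abelTerm R n s := by
    intro N
    have h := sum_Icc_by_parts R (fun n => (n : ℂ) ^ (-s)) N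
    rw [Nat.cast_one, Complex.one_cpow, mul_one] at h
    exact (Finset.sum_congr rfl fun n hn => by rw [ha n (Finset.mem_Icc.1 hn).1]).trans h
  have hboundary := (tendsto_add_atTop_iff_nat 1).2 (tendsto_mul_natCast_cpow_neg hR hs)
  refine (tendsto_add_atTop_iff_nat 1).1 (Tendsto.congr (fun N => (hparts N).symm) ?_)
  simpa using (tendsto_const_nhds.sub hboundary).add hsum.hasSum.tendsto_sum_nat

lemma dirichletConvergesTo_mul_cpow_iff {w s l : ℂ} :
    DirichletConvergesTo (fun n => a n * (n : ℂ) ^ (-w)) s l ↔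
      DirichletConvergesTo a (w + s) l := by
  refine tendsto_congr fun N => Finset.sum_congr rfl fun n hn => ?_
  rw [mul_assoc, ← Complex.cpow_add _ _ (Nat.cast_ne_zero.2 (by simp at hn; omega)), neg_add]

theorem exists_differentiableOn_dirichletConvergesTo {s₀ l : ℂ}
    (h : DirichletConvergesTo a s₀ l) :
    ∃ f : ℂ → ℂ, DifferentiableOn ℂ f {s | s₀.re < s.re} ∧
      ∀ s, s₀.re < s.re → DirichletConvergesTo a s (f s) := by
  set R : ℕ → ℂ := fun N => -∑ n ∈ Finset.Icc 1 N, a n * (n : ℂ) ^ (-s₀)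
  have hdiff : ∀ n, 1 ≤ n → a n * (n : ℂ) ^ (-s₀) = R (n - 1) - R n := fun n hn => by
    obtain ⟨m, rfl⟩ := Nat.exists_eq_add_of_le' hn
    simp only [R, Nat.add_sub_cancel, Finset.sum_Icc_succ_top (Nat.le_add_left 1 m)]
    ring
  obtain ⟨C, hC⟩ := h.norm.bddAbove_range
  have hR : ∀ n, 1 ≤ n → ‖R n‖ ≤ C * (n : ℝ) ^ (-(0 : ℝ)) := fun n _ => by
    simpa [R] using hC (Set.mem_range_self n)
  refine ⟨fun s => R 0 + ∑' n, abelTerm R n (s - s₀),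
    ((differentiableOn_tsum_abelTerm hR zero_le_one).comp
      (differentiable_id.sub_const s₀).differentiableOn fun s hs => ?_).const_add _,
    fun s hs => ?_⟩
  · simpa using hs
  · have := dirichletConvergesTo_abel hdiff hR zero_le_one (s := s - s₀) (by simpa using hs)
    rwa [dirichletConvergesTo_mul_cpow_iff, add_sub_cancel] at this

theorem differentiableOn_of_dirichletConvergesTo {f : ℂ → ℂ} {σ : ℝ}
    (hf : ∀ s : ℂ, σ < s.re → DirichletConvergesTo a s (f s)) :
    DifferentiableOn ℂ f {s | σ < s.re} := by
  intro s (hs : σ < s.re)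
  obtain ⟨σ', hσ, hσ'⟩ := exists_between hs
  obtain ⟨g, hg, hag⟩ := exists_differentiableOn_dirichletConvergesTo
    (hf σ' (by rwa [Complex.ofReal_re]))
  have hopen : IsOpen {s : ℂ | σ' < s.re} := isOpen_lt continuous_const Complex.continuous_re
  have hfg : Set.EqOn f g {s | σ' < s.re} := fun z hz =>
    tendsto_nhds_unique (hf z (hσ.trans hz)) (hag z (by simpa using hz))
  rw [Complex.ofReal_re] at hg
  exact ((hg.congr hfg).differentiableAt (hopen.mem_nhds hσ')).differentiableWithinAt

lemma DirichletConvergesTo.tendsto_zero {s l : ℂ} (h : DirichletConvergesTo a s l) :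
    Tendsto (fun n => a n * (n : ℂ) ^ (-s)) atTop (𝓝 0) := by
  have hdiff := ((tendsto_add_atTop_iff_nat 1).2 h).sub h
  rw [sub_self] at hdiff
  refine (tendsto_add_atTop_iff_nat 1).1 (hdiff.congr fun N => ?_)
  rw [Finset.sum_Icc_succ_top (by omega), add_sub_cancel_left]

lemma dirichletConvergesTo_LSeries {s : ℂ} (h : LSeriesSummable a s) :
    DirichletConvergesTo a s (LSeries a s) := by
  refine ((tendsto_add_atTop_iff_nat 1).2 h.hasSum.tendsto_sum_nat).congr fun N => ?_
  rw [Finset.sum_range_succ', LSeries.term_zero, add_zero, Finset.range_eq_Ico,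
    Finset.sum_Ico_add' (LSeries.term a s) 0 N 1]
  refine Finset.sum_congr rfl fun n hn => ?_
  rw [LSeries.term_of_ne_zero (by simp at hn; omega), Complex.cpow_neg, div_eq_mul_inv]

end Abel

section Mean

/-- `g` is locally integrable and has mean value `m` over the real line: its averages over
`[-T, T]` tend to `m` as `T → ∞`. -/
def HasMean (g : ℝ → ℂ) (m : ℂ) : Prop :=
  (∀ a b : ℝ, IntervalIntegrable g MeasureTheory.volume a b) ∧
    Tendsto (fun T : ℝ => ⨍ t in -T..T, g t) atTop (𝓝 m)

variable {g h : ℝ → ℂ} {m k : ℂ}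

lemma HasMean.add (hg : HasMean g m) (hh : HasMean h k) : HasMean (fun t => g t + h t) (m + k) := by
  refine ⟨fun a b => (hg.1 a b).add (hh.1 a b), (hg.2.add hh.2).congr fun T => ?_⟩
  simp only [interval_average_eq]
  rw [intervalIntegral.integral_add (hg.1 _ _) (hh.1 _ _), smul_add]

lemma HasMean.const_mul (hg : HasMean g m) (c : ℂ) : HasMean (fun t => c * g t) (c * m) := by
  refine ⟨fun a b => (hg.1 a b).const_mul c, (hg.2.const_mul c).congr fun T => ?_⟩
  simp only [interval_average_eq]
  rw [intervalIntegral.integral_const_mul, mul_smul_comm]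

lemma HasMean.norm_le {w : ℝ → ℝ} {C : ℝ} (hg : HasMean g m)
    (hw : HasMean (fun t => (w t : ℂ)) 1) (hgw : ∀ t, ‖g t‖ ≤ C * w t) : ‖m‖ ≤ C := by
  have hint : ∀ a b : ℝ, IntervalIntegrable w MeasureTheory.volume a b := fun a b => by
    have := hw.1 a b
    rw [intervalIntegrable_iff] at this ⊢
    exact this.re
  have hmean : Tendsto (fun T : ℝ => C * ⨍ t in -T..T, w t) atTop (𝓝 (C * 1)) := by
    refine (((Complex.continuous_re.tendsto _).comp hw.2).congr fun T => ?_).const_mul C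
    simp only [Function.comp_apply, interval_average_eq]
    rw [intervalIntegral.integral_ofReal, Complex.real_smul, ← Complex.ofReal_mul,
      Complex.ofReal_re, smul_eq_mul]
  rw [mul_one] at hmean
  refine le_of_tendsto_of_tendsto hg.2.norm hmean ?_
  filter_upwards [eventually_gt_atTop 0] with T hT
  have hT' : 0 < T - -T := by linarith
  rw [interval_average_eq, interval_average_eq, norm_smul, norm_inv, Real.norm_of_nonneg hT'.le,
    smul_eq_mul, mul_left_comm, ← intervalIntegral.integral_const_mul]
  gcongr
  exact intervalIntegral.norm_integral_le_of_norm_le (by linarith)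
    (Eventually.of_forall fun t _ => hgw t) ((hint _ _).const_mul C)

lemma hasMean_zero_of_norm_integral_le {C : ℝ} (hg : Continuous g)
    (hC : ∀ T > 0, ‖∫ t in -T..T, g t‖ ≤ C) : HasMean g 0 := by
  refine ⟨fun a b => hg.intervalIntegrable a b, ?_⟩
  have hlim : Tendsto (fun T : ℝ => T⁻¹ * C) atTop (𝓝 (0 * C)) :=
    tendsto_inv_atTop_zero.mul_const C
  rw [zero_mul] at hlim
  refine squeeze_zero_norm' ?_ hlim
  filter_upwards [eventually_gt_atTop 0] with T hT
  rw [interval_average_eq, norm_smul, norm_inv, Real.norm_of_nonneg (by linarith)]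
  have := hC T hT
  gcongr
  linarith

lemma hasMean_const (c : ℂ) : HasMean (fun _ => c) c := by
  refine ⟨fun a b => intervalIntegrable_const, tendsto_const_nhds.congr' ?_⟩
  filter_upwards [eventually_gt_atTop 0] with T hT
  rw [interval_average_eq, intervalIntegral.integral_const, inv_smul_smul₀ (by linarith)]

lemma hasMean_tsum {g : ℕ → ℝ → ℂ} {m : ℕ → ℂ} {u : ℕ → ℝ} (hcont : ∀ n, Continuous (g n))
    (hg : ∀ n, HasMean (g n) (m n)) (hu : Summable u) (hgu : ∀ n t, ‖g n t‖ ≤ u n) :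
    HasMean (fun t => ∑' n, g n t) (∑' n, m n) := by
  refine ⟨fun a b => (continuous_tsum hcont hu hgu).intervalIntegrable a b, ?_⟩
  have hint : ∀ T : ℝ, ⨍ t in -T..T, ∑' n, g n t = ∑' n, ⨍ t in -T..T, g n t := fun T => by
    have := intervalIntegral.hasSum_integral_of_dominated_convergence (a := -T) (b := T)
      (μ := MeasureTheory.volume) (fun n _ => u n) (fun n => (hcont n).aestronglyMeasurable)
      (fun n => Eventually.of_forall fun t _ => hgu n t)
      (Eventually.of_forall fun t _ => hu) intervalIntegrable_const
      (Eventually.of_forall fun t _ => (Summable.of_norm_bounded hu (hgu · t)).hasSum)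
    simp only [interval_average_eq]
    rw [← this.tsum_eq, this.summable.tsum_const_smul]
  simp_rw [hint]
  refine tendsto_tsum_of_dominated_convergence hu (fun n => (hg n).2) ?_
  filter_upwards [eventually_gt_atTop 0] with T hT n
  have hT' : 0 < T - -T := by linarith
  rw [interval_average_eq, norm_smul, norm_inv, Real.norm_of_nonneg hT'.le,
    inv_mul_le_iff₀ hT', mul_comm]
  exact (intervalIntegral.norm_integral_le_of_norm_le_const fun t _ => hgu n t).trans
    (by rw [abs_of_pos hT'])

lemma hasMean_of_hasMean_of_bounded {G : ℂ → ℂ} {σ₁ σ₂ D : ℝ}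
    (hG : DifferentiableOn ℂ G (Complex.re ⁻¹' Set.uIcc σ₁ σ₂))
    (hD : ∀ s : ℂ, s.re ∈ Set.uIcc σ₁ σ₂ → ‖G s‖ ≤ D)
    (h₁ : HasMean (fun t => G (σ₁ + t * Complex.I)) m) :
    HasMean (fun t => G (σ₂ + t * Complex.I)) m := by
  have hcont : ∀ σ ∈ Set.uIcc σ₁ σ₂, Continuous fun t : ℝ => G (σ + t * Complex.I) := fun σ hσ =>
    hG.continuousOn.comp_continuous (by fun_prop) fun t => by simpa using hσ
  have hdiff : HasMean (fun t : ℝ => G (σ₂ + t * Complex.I) - G (σ₁ + t * Complex.I)) 0 := by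
    refine hasMean_zero_of_norm_integral_le (C := D * |σ₂ - σ₁| + D * |σ₂ - σ₁|)
      ((hcont σ₂ Set.right_mem_uIcc).sub (hcont σ₁ Set.left_mem_uIcc)) fun T _ => ?_
    have hside : ∀ y : ℝ, ‖∫ x in σ₁..σ₂, G (x + y * Complex.I)‖ ≤ D * |σ₂ - σ₁| := fun y =>
      intervalIntegral.norm_integral_le_of_norm_le_const fun x hx =>
        hD _ (by simpa using Set.uIoc_subset_uIcc hx)
    have hrect := Complex.integral_boundary_rect_eq_zero_of_differentiableOn G
      (σ₁ + (-T : ℝ) * Complex.I) (σ₂ + T * Complex.I) (hG.mono fun s hs => by simpa using hs.1)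
    simp only [Complex.add_re, Complex.ofReal_re, Complex.re_ofReal_mul, Complex.I_re, mul_zero,
      add_zero, Complex.add_im, Complex.ofReal_im, Complex.im_ofReal_mul, Complex.I_im, mul_one,
      zero_add] at hrect
    rw [intervalIntegral.integral_sub ((hcont σ₂ Set.right_mem_uIcc).intervalIntegrable _ _)
      ((hcont σ₁ Set.left_mem_uIcc).intervalIntegrable _ _)]
    rw [add_sub_assoc, ← smul_sub, add_eq_zero_iff_neg_eq] at hrect
    calc _ = ‖Complex.I • ((∫ t in -T..T, G (σ₂ + t * Complex.I)) -
          ∫ t in -T..T, G (σ₁ + t * Complex.I))‖ := by rw [norm_smul, Complex.norm_I, one_mul]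
      _ ≤ _ := by
        rw [← hrect, norm_neg]
        exact (norm_sub_le _ _).trans (add_le_add (hside _) (hside _))
  simpa using h₁.add hdiff

end Mean

section RatChar

/-- The character `t ↦ r ^ (i t)` of the real line attached to a positive rational `r`. -/
noncomputable def ratChar (r : ℚ) (t : ℝ) : ℂ := ((r : ℝ) : ℂ) ^ (t * Complex.I)

variable {r : ℚ}

lemma continuous_ratChar (hr : 0 < r) : Continuous (ratChar r) := by
  unfold ratChar
  exact Continuous.const_cpow (by fun_prop) (Or.inl (by exact_mod_cast hr.ne'))

lemma norm_ratChar (hr : 0 < r) (t : ℝ) : ‖ratChar r t‖ = 1 := by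
  rw [ratChar, Complex.norm_cpow_eq_rpow_re_of_pos (by exact_mod_cast hr)]
  simp

lemma ratChar_one : ratChar 1 = 1 := by
  ext t
  simp [ratChar]

lemma ratChar_mul {q : ℚ} (hr : 0 < r) (hq : 0 < q) (t : ℝ) :
    ratChar (r * q) t = ratChar r t * ratChar q t := by
  rw [ratChar, Rat.cast_mul, Complex.ofReal_mul]
  exact Complex.mul_cpow_ofReal_nonneg (by exact_mod_cast hr.le) (by exact_mod_cast hq.le) _

lemma ratChar_inv (hr : 0 < r) (t : ℝ) : ratChar r⁻¹ t = (starRingEnd ℂ) (ratChar r t) := by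
  have hmul : ratChar r t * ratChar r⁻¹ t = 1 := by
    rw [← ratChar_mul hr (inv_pos.2 hr), mul_inv_cancel₀ hr.ne', ratChar_one, Pi.one_apply]
  rw [eq_inv_of_mul_eq_one_right hmul, Complex.inv_eq_conj (norm_ratChar hr t)]

lemma hasMean_ratChar (hr : 0 < r) : HasMean (ratChar r) (if r = 1 then 1 else 0) := by
  split_ifs with h
  · rw [h, ratChar_one]
    exact hasMean_const 1
  have hr' : (0 : ℝ) < r := by exact_mod_cast hr
  have hlog : Real.log r ≠ 0 :=
    Real.log_ne_zero_of_pos_of_ne_one hr' (by exact_mod_cast h)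
  set c : ℂ := Real.log r * Complex.I
  have hc : c ≠ 0 := mul_ne_zero (Complex.ofReal_ne_zero.2 hlog) Complex.I_ne_zero
  have hexp : ∀ t : ℝ, ratChar r t = Complex.exp (c * t) := fun t => by
    rw [ratChar, Complex.cpow_def_of_ne_zero (by exact_mod_cast hr'.ne'),
      ← Complex.ofReal_log hr'.le]
    congr 1
    ring
  refine hasMean_zero_of_norm_integral_le (C := 2 / ‖c‖) (continuous_ratChar hr) fun T _ => ?_
  simp_rw [hexp]
  rw [integral_exp_mul_complex hc, norm_div, ← hexp, ← hexp]
  gcongr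
  exact (norm_sub_le _ _).trans (by rw [norm_ratChar hr, norm_ratChar hr]; norm_num)

/-- The coefficients `b` extended by zero from the natural to the rational numbers. -/
noncomputable def ratCoeff (b : ℕ → ℂ) : ℚ → ℂ := Function.extend (Nat.cast : ℕ → ℚ) b 0

lemma ratCoeff_natCast (b : ℕ → ℂ) (n : ℕ) : ratCoeff b n = b n :=
  Nat.cast_injective.extend_apply b (0 : ℚ → ℂ) n

lemma ratCoeff_eq_zero (b : ℕ → ℂ) (h : ¬∃ n : ℕ, (n : ℚ) = r) : ratCoeff b r = 0 :=
  Function.extend_apply' b (0 : ℚ → ℂ) r h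

lemma term_mul_cpow (b : ℕ → ℂ) (σ t : ℝ) (hr : 0 < r) (n : ℕ) :
    LSeries.term b (σ + t * Complex.I) n * ((r : ℝ) : ℂ) ^ (σ + t * Complex.I) =
      LSeries.term b σ n * ((r : ℝ) : ℂ) ^ (σ : ℂ) * ratChar (r / n) t := by
  obtain rfl | hn := Nat.eq_zero_or_pos n
  · simp
  have hr' : ((r : ℝ) : ℂ) ≠ 0 := by exact_mod_cast hr.ne'
  have hn' : (n : ℂ) ≠ 0 := Nat.cast_ne_zero.2 hn.ne'
  have hratio : ((r : ℝ) : ℂ) ^ (t * Complex.I) =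
      ratChar (r / n) t * (n : ℂ) ^ (t * Complex.I) := by
    have := ratChar_mul (div_pos hr (Nat.cast_pos.2 hn)) (Nat.cast_pos.2 hn) t
    rw [div_mul_cancel₀ r (Nat.cast_ne_zero.2 hn.ne')] at this
    simpa [ratChar] using this
  rw [LSeries.term_of_ne_zero hn.ne', LSeries.term_of_ne_zero hn.ne', Complex.cpow_add _ _ hn',
    Complex.cpow_add _ _ hr', hratio]
  field_simp [Complex.cpow_ne_zero_iff, hn']

lemma tsum_term_mul_cpow (b : ℕ → ℂ) (s : ℂ) (hr : 0 < r) :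
    ∑' n : ℕ, LSeries.term b s n * ((r : ℝ) : ℂ) ^ s * (if r / n = 1 then 1 else 0) =
      ratCoeff b r := by
  have hzero : ∀ n : ℕ, (n : ℚ) ≠ r →
      LSeries.term b s n * ((r : ℝ) : ℂ) ^ s * (if r / n = 1 then 1 else 0) = 0 := fun n hn => by
    rw [if_neg fun h => hn (eq_of_div_eq_one h).symm, mul_zero]
  by_cases hex : ∃ n : ℕ, (n : ℚ) = r
  · obtain ⟨n, rfl⟩ := hex
    have hn : n ≠ 0 := by rintro rfl; simp at hr
    rw [tsum_eq_single n fun k hk => hzero k (by exact_mod_cast hk), ratCoeff_natCast,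
      LSeries.term_of_ne_zero hn, if_pos (div_self hr.ne'), mul_one]
    exact div_mul_cancel₀ _ (by simp [Complex.cpow_eq_zero_iff, hn])
  · rw [ratCoeff_eq_zero b hex, tsum_congr fun n => hzero n fun h => hex ⟨n, h⟩, tsum_zero]

lemma hasMean_LSeries_mul_cpow {b : ℕ → ℂ} {σ : ℝ} (hb : LSeriesSummable b σ) (hr : 0 < r) :
    HasMean (fun t => LSeries b (σ + t * Complex.I) * ((r : ℝ) : ℂ) ^ (σ + t * Complex.I))
      (ratCoeff b r) := by
  set c : ℕ → ℂ := fun n => LSeries.term b σ n * ((r : ℝ) : ℂ) ^ (σ : ℂ)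
  have hc0 : c 0 = 0 := by simp [c]
  have hratio : ∀ n : ℕ, n ≠ 0 → 0 < r / n := fun n hn =>
    div_pos hr (Nat.cast_pos.2 (Nat.pos_of_ne_zero hn))
  have hcont : ∀ n : ℕ, Continuous fun t => c n * ratChar (r / n) t := fun n => by
    obtain rfl | hn := eq_or_ne n 0
    · simpa only [hc0, zero_mul] using continuous_const
    · exact continuous_const.mul (continuous_ratChar (hratio n hn))
  have hmean : ∀ n : ℕ, HasMean (fun t => c n * ratChar (r / n) t)
      (c n * if r / n = 1 then 1 else 0) := fun n => by
    obtain rfl | hn := eq_or_ne n 0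
    · simpa only [hc0, zero_mul] using hasMean_const 0
    · exact (hasMean_ratChar (hratio n hn)).const_mul (c n)
  have hbound : ∀ (n : ℕ) t, ‖c n * ratChar (r / n) t‖ ≤ ‖c n‖ := fun n t => by
    obtain rfl | hn := eq_or_ne n 0
    · simp [hc0]
    · rw [norm_mul, norm_ratChar (hratio n hn), mul_one]
  simp_rw [LSeries, ← tsum_mul_right, term_mul_cpow b σ _ hr, ← tsum_term_mul_cpow b σ hr]
  exact hasMean_tsum hcont hmean (hb.mul_right _).norm hbound

theorem hasMean_mul_ratChar {b : ℕ → ℂ} {f : ℂ → ℂ} {η C : ℝ} (hη : 0 < η)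
    (hf : ∀ s : ℂ, -η < s.re → DirichletConvergesTo b s (f s))
    (hfC : ∀ s : ℂ, -η < s.re → ‖f s‖ ≤ C) (hr : 0 < r) :
    HasMean (fun t => f (t * Complex.I) * ratChar r t) (ratCoeff b r) := by
  have hr' : ((r : ℝ) : ℂ) ≠ 0 := by exact_mod_cast hr.ne'
  set G : ℂ → ℂ := fun s => f s * ((r : ℝ) : ℂ) ^ s
  have hstrip : ∀ s : ℂ, s.re ∈ Set.uIcc (2 : ℝ) 0 → -η < s.re := fun s hs => by
    rw [Set.uIcc_of_ge zero_le_two] at hs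
    linarith [hs.1]
  have hG : DifferentiableOn ℂ G (Complex.re ⁻¹' Set.uIcc 2 0) :=
    ((differentiableOn_of_dirichletConvergesTo hf).mono hstrip).mul
      (differentiable_id.const_cpow (Or.inl hr')).differentiableOn
  obtain ⟨D, hD⟩ := isCompact_uIcc.exists_bound_of_continuousOn
    (Real.continuous_const_rpow (a := r) (by exact_mod_cast hr.ne')).continuousOn
    (s := Set.uIcc (2 : ℝ) 0)
  have hGD : ∀ s : ℂ, s.re ∈ Set.uIcc (2 : ℝ) 0 → ‖G s‖ ≤ C * D := fun s hs => by
    have hrs := hD s.re hs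
    rw [Real.norm_of_nonneg (by positivity)] at hrs
    rw [norm_mul, Complex.norm_cpow_eq_rpow_re_of_pos (by exact_mod_cast hr)]
    exact mul_le_mul (hfC s (hstrip s hs)) hrs (by positivity)
      ((norm_nonneg _).trans (hfC s (hstrip s hs)))
  obtain ⟨B, hB⟩ := (hf 0 (by simpa using hη)).tendsto_zero.norm.bddAbove_range
  have hsum : ∀ s : ℂ, 1 < s.re → LSeriesSummable b s := fun s hs =>
    LSeriesSummable_of_bounded_of_one_lt_re
      (fun n _ => by simpa using hB (Set.mem_range_self n)) hs
  have h₂ : HasMean (fun t => G ((2 : ℝ) + t * Complex.I)) (ratCoeff b r) := by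
    convert hasMean_LSeries_mul_cpow (hsum (2 : ℝ) (by simp)) hr using 4 with t
    exact tendsto_nhds_unique (hf _ (by simp; linarith))
      (dirichletConvergesTo_LSeries (hsum _ (by simp)))
  simpa [G, ratChar] using hasMean_of_hasMean_of_bounded hG hGD h₂

end RatChar

section Riesz

/-- The Riesz product `∏_{n ∈ S} (1 + 2 Re (l n * n ^ (i t)))`, which is nonnegative when
`‖l n‖ ≤ 1 / 2` and serves as a density on the line that singles out the coefficients of a
Dirichlet series at the products of distinct elements of `S`. -/
noncomputable def rieszProduct (S : Finset ℕ) (l : ℕ → ℂ) (t : ℝ) : ℝ :=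
  ∏ n ∈ S, (1 + 2 * (l n * ratChar n t).re)

variable {S : Finset ℕ} {l : ℕ → ℂ} {b : ℕ → ℂ} {F : ℝ → ℂ}

lemma rieszProduct_nonneg (hS : ∀ n ∈ S, 0 < n) (hl : ∀ n, ‖l n‖ ≤ 1 / 2) (t : ℝ) :
    0 ≤ rieszProduct S l t := by
  refine Finset.prod_nonneg fun n hn => ?_
  have hre := neg_le_of_abs_le (Complex.abs_re_le_norm (l n * ratChar n t))
  rw [norm_mul, norm_ratChar (Nat.cast_pos.2 (hS n hn)), mul_one] at hre
  linarith [hl n]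

lemma rieszProduct_insert {a : ℕ} (ha : a ∉ S) (ha0 : 0 < a) (t : ℝ) :
    (rieszProduct (insert a S) l t : ℂ) =
      (1 + l a * ratChar a t + (starRingEnd ℂ) (l a) * ratChar (a : ℚ)⁻¹ t) *
        rieszProduct S l t := by
  rw [rieszProduct, Finset.prod_insert ha, Complex.ofReal_mul, ratChar_inv (Nat.cast_pos.2 ha0),
    add_assoc, ← map_mul, Complex.add_conj, Complex.ofReal_add, Complex.ofReal_one]
  rfl

lemma ratCoeff_div_mul_prod_eq_zero (b : ℕ → ℂ) {A : Finset ℕ} {a x y : ℕ} (ha : 1 < a)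
    (hy : 0 < y) (hx : a.Coprime x) (hA : ∀ n ∈ A, a.Coprime n) :
    ratCoeff b (x / (y * a : ℕ) * (∏ n ∈ A, n : ℕ)) = 0 := by
  refine ratCoeff_eq_zero b ?_
  rintro ⟨m, hm⟩
  have heq : (x : ℚ) * (∏ n ∈ A, n : ℕ) = a * (y * m) := by
    rw [Nat.cast_mul] at hm
    rw [hm]
    field_simp
  have hdvd : a ∣ x * ∏ n ∈ A, n := ⟨y * m, by exact_mod_cast heq⟩
  exact ha.ne' ((hx.mul_right (Nat.Coprime.prod_right hA)).eq_one_of_dvd hdvd)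

/-- The fraction `x / y` is an arbitrary positive rational because the induction on `S` both
multiplies and divides by the elements of `S`; coprimality of `x` to `S` makes every term that
contains a division vanish. -/
theorem hasMean_mul_rieszProduct
    (hF : ∀ r : ℚ, 0 < r → HasMean (fun t => F t * ratChar r t) (ratCoeff b r))
    (hS : ∀ n ∈ S, 1 < n) (hco : (S : Set ℕ).Pairwise Nat.Coprime) {x y : ℕ} (hx : 0 < x)
    (hy : 0 < y) (hxS : ∀ n ∈ S, n.Coprime x) :
    HasMean (fun t => F t * ratChar (x / y) t * rieszProduct S l t)
      (∑ A ∈ S.powerset, (∏ n ∈ A, l n) * ratCoeff b (x / y * (∏ n ∈ A, n : ℕ))) := by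
  induction S using Finset.induction_on generalizing x y with
  | empty => simpa [rieszProduct] using hF (x / y) (by positivity)
  | insert a S ha ih =>
    have ha1 : 1 < a := hS a (Finset.mem_insert_self a S)
    have haS : ∀ n ∈ S, a.Coprime n := fun n hn =>
      hco (Finset.mem_insert_self a S) (Finset.mem_insert_of_mem hn)
        (ne_of_mem_of_not_mem hn ha).symm
    have hax : a.Coprime x := hxS a (Finset.mem_insert_self a S)
    have ih := @ih (fun n hn => hS n (Finset.mem_insert_of_mem hn)) (hco.mono (by simp))
    have hxS : ∀ n ∈ S, n.Coprime x := fun n hn => hxS n (Finset.mem_insert_of_mem hn)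
    have ha0 : (0 : ℚ) < a := by positivity
    have hxy : (0 : ℚ) < x / y := by positivity
    have h₁ := ih hx hy hxS
    have h₂ := (ih (x := x * a) (by positivity) hy fun n hn =>
      (hxS n hn).mul_right (haS n hn).symm).const_mul (l a)
    have h₃ := (ih (y := y * a) hx (by positivity) hxS).const_mul ((starRingEnd ℂ) (l a))
    rw [Finset.sum_eq_zero fun A hA => by
      rw [ratCoeff_div_mul_prod_eq_zero b ha1 hy hax fun n hn =>
        haS n (Finset.mem_powerset.1 hA hn), mul_zero], mul_zero] at h₃
    convert (h₁.add h₂).add h₃ using 1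
    · ext t
      rw [rieszProduct_insert ha (by positivity), Nat.cast_mul, Nat.cast_mul, mul_div_right_comm,
        ratChar_mul hxy ha0, ← div_div, div_eq_mul_inv (x / y : ℚ),
        ratChar_mul hxy (inv_pos.2 ha0)]
      ring
    · rw [Finset.sum_powerset_insert ha, add_zero, Finset.mul_sum]
      congr 1
      refine Finset.sum_congr rfl fun A hA => ?_
      have haA : a ∉ A := fun h => ha (Finset.mem_powerset.1 hA h)
      rw [Finset.prod_insert haA, Finset.prod_insert haA]
      push_cast
      ring_nf

lemma ratCoeff_single_one (r : ℚ) : ratCoeff (Pi.single 1 1) r = if r = 1 then 1 else 0 := by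
  by_cases hex : ∃ n : ℕ, (n : ℚ) = r
  · obtain ⟨n, rfl⟩ := hex
    simp [ratCoeff_natCast, Pi.single_apply]
  · rw [ratCoeff_eq_zero _ hex, if_neg fun h => hex ⟨1, by simp [h]⟩]

lemma hasMean_rieszProduct (hS : ∀ n ∈ S, 1 < n) (hco : (S : Set ℕ).Pairwise Nat.Coprime) :
    HasMean (fun t => (rieszProduct S l t : ℂ)) 1 := by
  have h := hasMean_mul_rieszProduct (F := fun _ => 1) (b := Pi.single 1 1) (l := l)
    (fun r hr => by simpa [ratCoeff_single_one] using hasMean_ratChar hr) hS hco one_pos one_pos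
    fun n _ => n.coprime_one_right
  rw [Finset.sum_eq_single_of_mem ∅ (Finset.empty_mem_powerset S)] at h
  · simpa [ratChar_one, ratCoeff_single_one] using h
  · intro A hA hA0
    obtain ⟨n, hn⟩ := Finset.nonempty_iff_ne_empty.2 hA0
    have hprod : ∏ n ∈ A, n ≠ 1 := fun h =>
      (hS n (Finset.mem_powerset.1 hA hn)).ne' (Finset.prod_eq_one_iff.1 h n hn)
    rw [ratCoeff_single_one, if_neg, mul_zero]
    rw [Nat.cast_one, div_one, one_mul]
    exact_mod_cast hprod

theorem norm_sum_powerset_mul_le {C : ℝ}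
    (hF : ∀ r : ℚ, 0 < r → HasMean (fun t => F t * ratChar r t) (ratCoeff b r))
    (hFC : ∀ t, ‖F t‖ ≤ C) (hS : ∀ n ∈ S, 1 < n) (hco : (S : Set ℕ).Pairwise Nat.Coprime)
    (hl : ∀ n, ‖l n‖ ≤ 1 / 2) :
    ‖∑ A ∈ S.powerset, (∏ n ∈ A, l n) * b (∏ n ∈ A, n)‖ ≤ C := by
  have h := hasMean_mul_rieszProduct (l := l) hF hS hco one_pos one_pos
    fun n _ => n.coprime_one_right
  simp only [Nat.cast_one, div_one, one_mul, ratChar_one, Pi.one_apply, mul_one] at h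
  simp only [ratCoeff_natCast] at h
  refine h.norm_le (hasMean_rieszProduct (l := l) hS hco) fun t => ?_
  have hnonneg := rieszProduct_nonneg (fun n hn => zero_lt_one.trans (hS n hn)) hl t
  rw [norm_mul, Complex.norm_real, Real.norm_of_nonneg hnonneg]
  gcongr
  exact hFC t

end Riesz

section Khinchine

variable {ι κ E : Type*}

/-- The sum of `± c i` over `i ∈ s` with the sign `+` exactly on `A`; averaging over the subsets
`A` of `s` averages over all choices of signs. -/
def signSum [DecidableEq ι] [AddCommGroup E] (s A : Finset ι) (c : ι → E) : E :=
  ∑ i ∈ s, if i ∈ A then c i else -c i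

lemma sum_powerset_insert_signSum [DecidableEq ι] [AddCommGroup E] {s : Finset ι} {a : ι}
    (ha : a ∉ s) (c : ι → E) (φ : E → ℝ) :
    ∑ A ∈ (insert a s).powerset, φ (signSum (insert a s) A c) =
      ∑ A ∈ s.powerset, (φ (signSum s A c - c a) + φ (signSum s A c + c a)) := by
  rw [Finset.sum_powerset_insert ha, ← Finset.sum_add_distrib]
  refine Finset.sum_congr rfl fun A hA => ?_
  have haA : a ∉ A := fun h => ha (Finset.mem_powerset.1 hA h)
  have hcongr : ∑ i ∈ s, (if i ∈ insert a A then c i else -c i) = signSum s A c :=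
    Finset.sum_congr rfl fun i hi => by
      simp only [Finset.mem_insert, ne_of_mem_of_not_mem hi ha, false_or]
  rw [signSum, signSum, Finset.sum_insert ha, Finset.sum_insert ha, if_neg haA,
    if_pos (Finset.mem_insert_self a A), hcongr, neg_add_eq_sub, add_comm (c a)]
  rfl

variable [NormedAddCommGroup E] [InnerProductSpace ℝ E]

lemma sum_norm_signSum_sq [DecidableEq ι] (s : Finset ι) (c : ι → E) :
    ∑ A ∈ s.powerset, ‖signSum s A c‖ ^ 2 = 2 ^ s.card * ∑ i ∈ s, ‖c i‖ ^ 2 := by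
  induction s using Finset.induction_on with
  | empty => simp [signSum]
  | insert a s ha ih =>
    have hpar : ∀ z w : E, ‖z - w‖ ^ 2 + ‖z + w‖ ^ 2 = 2 * ‖z‖ ^ 2 + 2 * ‖w‖ ^ 2 := fun z w => by
      linear_combination parallelogram_law_with_norm ℝ z w
    rw [sum_powerset_insert_signSum ha c (fun z => ‖z‖ ^ 2)]
    simp only [hpar, Finset.sum_add_distrib, ← Finset.mul_sum, ih, Finset.sum_const,
      Finset.card_powerset, Finset.card_insert_of_notMem ha, Finset.sum_insert ha, nsmul_eq_mul]
    push_cast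
    ring

lemma norm_sub_pow_four_add_le (z w : E) :
    ‖z - w‖ ^ 4 + ‖z + w‖ ^ 4 ≤ 2 * ‖z‖ ^ 4 + 12 * (‖z‖ ^ 2 * ‖w‖ ^ 2) + 2 * ‖w‖ ^ 4 := by
  have hadd := norm_add_sq_real z w
  have hsub := norm_sub_sq_real z w
  have hinner : inner ℝ z w ^ 2 ≤ ‖z‖ ^ 2 * ‖w‖ ^ 2 := by
    rw [← mul_pow]
    exact sq_le_sq' (neg_le_of_abs_le (abs_real_inner_le_norm z w)) (real_inner_le_norm z w)
  calc ‖z - w‖ ^ 4 + ‖z + w‖ ^ 4 = (‖z - w‖ ^ 2) ^ 2 + (‖z + w‖ ^ 2) ^ 2 := by ring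
    _ = 2 * (‖z‖ ^ 2 + ‖w‖ ^ 2) ^ 2 + 8 * inner ℝ z w ^ 2 := by rw [hadd, hsub]; ring
    _ ≤ _ := by linarith

lemma sum_norm_signSum_pow_four_le [DecidableEq ι] (s : Finset ι) (c : ι → E) :
    ∑ A ∈ s.powerset, ‖signSum s A c‖ ^ 4 ≤ 3 * 2 ^ s.card * (∑ i ∈ s, ‖c i‖ ^ 2) ^ 2 := by
  induction s using Finset.induction_on with
  | empty => simp [signSum]
  | insert a s ha ih =>
    rw [sum_powerset_insert_signSum ha c (fun z => ‖z‖ ^ 4)]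
    refine (Finset.sum_le_sum fun A _ => norm_sub_pow_four_add_le _ _).trans ?_
    simp only [Finset.sum_add_distrib, ← Finset.mul_sum, ← Finset.sum_mul, sum_norm_signSum_sq,
      Finset.sum_const, Finset.card_powerset, Finset.card_insert_of_notMem ha,
      Finset.sum_insert ha, nsmul_eq_mul]
    push_cast
    have hpos : (0 : ℝ) ≤ 2 ^ s.card * ‖c a‖ ^ 4 := by positivity
    rw [pow_succ (2 : ℝ) s.card]
    nlinarith

theorem sqrt_sum_norm_sq_le_sum_norm_signSum [DecidableEq ι] (s : Finset ι) (c : ι → E) :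
    2 ^ s.card * √(∑ i ∈ s, ‖c i‖ ^ 2) ≤ 9 / 5 * ∑ A ∈ s.powerset, ‖signSum s A c‖ := by
  set σ := √(∑ i ∈ s, ‖c i‖ ^ 2)
  have hσ : ∑ i ∈ s, ‖c i‖ ^ 2 = σ ^ 2 :=
    (Real.sq_sqrt (Finset.sum_nonneg fun i _ => by positivity)).symm
  obtain h0 | hpos := (Real.sqrt_nonneg (∑ i ∈ s, ‖c i‖ ^ 2)).eq_or_lt
  · rw [show σ = 0 from h0.symm, mul_zero]
    positivity
  -- The difference of the two sides has a double zero at `t = 3 σ / 2`.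
  have hquartic : ∀ t : ℝ, 0 ≤ t → t ^ 2 * σ ^ 2 - 4 / 27 * t ^ 4 ≤ t * σ ^ 3 := fun t ht => by
    have : 0 ≤ 4 / 27 * (t * ((t - 3 / 2 * σ) ^ 2 * (t + 3 * σ))) := by positivity
    linarith
  have hsum : ∑ A ∈ s.powerset, (‖signSum s A c‖ ^ 2 * σ ^ 2 - 4 / 27 * ‖signSum s A c‖ ^ 4) ≤
      ∑ A ∈ s.powerset, ‖signSum s A c‖ * σ ^ 3 :=
    Finset.sum_le_sum fun A _ => hquartic _ (norm_nonneg _)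
  rw [Finset.sum_sub_distrib, ← Finset.sum_mul, ← Finset.sum_mul, ← Finset.mul_sum,
    sum_norm_signSum_sq, hσ] at hsum
  have hfour := sum_norm_signSum_pow_four_le s c
  rw [hσ] at hfour
  have hσ3 : 0 < σ ^ 3 := pow_pos hpos 3
  refine le_of_mul_le_mul_right ?_ hσ3
  linarith

theorem sum_sqrt_sum_norm_sq_le {S : Finset ι} {T : Finset κ} {c : ι → κ → ℂ} {K : ℝ}
    (hK : ∀ x : ι → ℂ, (∀ i, ‖x i‖ ≤ 1) → ∑ j ∈ T, ‖∑ i ∈ S, x i * c i j‖ ≤ K) :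
    ∑ j ∈ T, √(∑ i ∈ S, ‖c i j‖ ^ 2) ≤ 9 / 5 * K := by
  classical
  have hsign : ∀ A, ∑ j ∈ T, ‖signSum S A (c · j)‖ ≤ K := fun A => by
    convert hK (fun i => if i ∈ A then 1 else -1) fun i => by split_ifs <;> simp using 3 with j
    simp only [signSum, ite_mul, one_mul, neg_one_mul]
  refine le_of_mul_le_mul_left ?_ (by positivity : (0 : ℝ) < 2 ^ S.card)
  calc 2 ^ S.card * ∑ j ∈ T, √(∑ i ∈ S, ‖c i j‖ ^ 2)
      ≤ ∑ j ∈ T, 9 / 5 * ∑ A ∈ S.powerset, ‖signSum S A (c · j)‖ := by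
        rw [Finset.mul_sum]
        exact Finset.sum_le_sum fun j _ => sqrt_sum_norm_sq_le_sum_norm_signSum S (c · j)
    _ = 9 / 5 * ∑ A ∈ S.powerset, ∑ j ∈ T, ‖signSum S A (c · j)‖ := by
        rw [← Finset.mul_sum, Finset.sum_comm]
    _ ≤ 9 / 5 * ∑ _A ∈ S.powerset, K := by
        gcongr
        exact hsign _
    _ = 2 ^ S.card * (9 / 5 * K) := by
        rw [Finset.sum_const, Finset.card_powerset, nsmul_eq_mul]
        push_cast
        ring

end Khinchine

section DegreeTwo

lemma sum_norm_le_of_forall_norm_sum_le {ι : Type*} {S : Finset ι} {c : ι → ℂ} {ρ C : ℝ}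
    (hρ : 0 ≤ ρ) (h : ∀ y : ι → ℂ, (∀ i, ‖y i‖ ≤ ρ) → ‖∑ i ∈ S, y i * c i‖ ≤ C) :
    ρ * ∑ i ∈ S, ‖c i‖ ≤ C := by
  set y : ι → ℂ := fun i => ρ * ((starRingEnd ℂ) (c i) / ‖c i‖)
  have hy : ∀ i, ‖y i‖ ≤ ρ := fun i => by
    rw [norm_mul, norm_div, RCLike.norm_conj, Complex.norm_real, Complex.norm_real, norm_norm,
      Real.norm_of_nonneg hρ]
    exact mul_le_of_le_one_right hρ (div_self_le_one _)
  have hyc : ∀ i, y i * c i = (ρ * ‖c i‖ : ℝ) := fun i => by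
    obtain h0 | h0 := eq_or_ne (c i) 0
    · simp [h0]
    · have : (‖c i‖ : ℂ) ≠ 0 := by simpa using h0
      push_cast
      rw [mul_assoc, div_mul_eq_mul_div, Complex.conj_mul', sq, mul_div_cancel_right₀ _ this]
  have hbound := h y hy
  rw [Finset.sum_congr rfl fun i _ => hyc i, ← Complex.ofReal_sum, Complex.norm_real,
    ← Finset.mul_sum] at hbound
  exact (le_abs_self _).trans hbound

variable {ι : Type*}

lemma sum_powerset_eq_add_sum {S : Finset ι} {g : Finset ι → ℂ}
    (hg : ∀ A ⊆ S, 1 < A.card → g A = 0) : ∑ A ∈ S.powerset, g A = g ∅ + ∑ p ∈ S, g {p} := by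
  classical
  induction S using Finset.induction_on with
  | empty => simp
  | insert a S ha ih =>
    rw [Finset.sum_powerset_insert ha, Finset.sum_insert ha,
      ih fun A hA => hg A (hA.trans (Finset.subset_insert a S)),
      Finset.sum_eq_single_of_mem ∅ (Finset.empty_mem_powerset S)]
    · rw [insert_empty_eq]
      ring
    · intro A hA hA0
      refine hg _ (Finset.insert_subset_insert a (Finset.mem_powerset.1 hA)) ?_
      rw [Finset.card_insert_of_notMem fun h => ha (Finset.mem_powerset.1 hA h)]
      exact Nat.succ_lt_succ (Finset.card_pos.2 (Finset.nonempty_iff_ne_empty.2 hA0))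

lemma sum_powerset_sum_mem [DecidableEq ι] (S : Finset ι) (g : ι → Finset ι → ℂ) :
    ∑ A ∈ S.powerset, ∑ q ∈ A, g q (A.erase q) = ∑ q ∈ S, ∑ B ∈ (S.erase q).powerset, g q B := by
  rw [Finset.sum_comm' (t' := S) (s' := fun q => S.powerset.filter (q ∈ ·)) (by simp; grind)]
  refine Finset.sum_congr rfl fun q hq => Finset.sum_nbij' (·.erase q) (insert q ·) ?_ ?_ ?_ ?_ ?_
    <;> simp <;> grind

lemma prod_add_sub_prod_sub [DecidableEq ι] {A : Finset ι} (hA : A.card ≤ 2) (x y : ι → ℂ) :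
    ∏ i ∈ A, (x i + y i) - ∏ i ∈ A, (x i - y i) = 2 * ∑ q ∈ A, y q * ∏ i ∈ A.erase q, x i := by
  obtain h | h | h : A.card = 0 ∨ A.card = 1 ∨ A.card = 2 := by omega
  · simp [Finset.card_eq_zero.1 h]
  · obtain ⟨a, rfl⟩ := Finset.card_eq_one.1 h
    simp only [Finset.prod_singleton, Finset.sum_singleton, Finset.erase_singleton,
      Finset.prod_empty]
    ring
  · obtain ⟨a, b, hab, rfl⟩ := Finset.card_eq_two.1 h
    rw [Finset.prod_pair hab, Finset.prod_pair hab, Finset.sum_pair hab,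
      Finset.erase_insert (by simpa using hab), Finset.pair_comm,
      Finset.erase_insert (by simpa using hab.symm), Finset.prod_singleton, Finset.prod_singleton]
    ring

theorem sum_powerset_polarization [DecidableEq ι] {S : Finset ι} {c : Finset ι → ℂ}
    (hc : ∀ A ⊆ S, 2 < A.card → c A = 0) (x y : ι → ℂ) :
    ∑ A ∈ S.powerset, (∏ i ∈ A, (x i + y i)) * c A -
        ∑ A ∈ S.powerset, (∏ i ∈ A, (x i - y i)) * c A =
      2 * ∑ q ∈ S, y q * (c {q} + ∑ p ∈ S.erase q, x p * c {p, q}) := by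
  have hterm : ∀ A ∈ S.powerset, (∏ i ∈ A, (x i + y i)) * c A - (∏ i ∈ A, (x i - y i)) * c A =
      2 * ∑ q ∈ A, y q * ((∏ i ∈ A.erase q, x i) * c (insert q (A.erase q))) := fun A hA => by
    rw [← sub_mul]
    obtain h | h := le_or_gt A.card 2
    · rw [prod_add_sub_prod_sub h, mul_assoc, Finset.sum_mul]
      congr 1
      exact Finset.sum_congr rfl fun q hq => by rw [Finset.insert_erase hq, mul_assoc]
    · rw [hc A (Finset.mem_powerset.1 hA) h, mul_zero, Finset.sum_eq_zero, mul_zero]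
      intro q hq
      rw [Finset.insert_erase hq, hc A (Finset.mem_powerset.1 hA) h, mul_zero, mul_zero]
  rw [← Finset.sum_sub_distrib, Finset.sum_congr rfl hterm, ← Finset.mul_sum,
    sum_powerset_sum_mem S fun q B => y q * ((∏ i ∈ B, x i) * c (insert q B))]
  congr 1
  refine Finset.sum_congr rfl fun q hq => ?_
  rw [← Finset.mul_sum, sum_powerset_eq_add_sum]
  · simp [Finset.pair_comm]
  · intro B hB hcard
    have hqB : q ∉ B := fun h => Finset.notMem_erase q S (hB h)
    rw [hc _ (Finset.insert_subset hq (hB.trans (Finset.erase_subset q S))), mul_zero]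
    rw [Finset.card_insert_of_notMem hqB]
    omega

variable {S : Finset ι} {c : Finset ι → ℂ} {C : ℝ}

lemma sum_norm_add_sum_le [DecidableEq ι] (hc : ∀ A ⊆ S, 2 < A.card → c A = 0)
    (hC : ∀ l : ι → ℂ, (∀ i, ‖l i‖ ≤ 1 / 2) → ‖∑ A ∈ S.powerset, (∏ i ∈ A, l i) * c A‖ ≤ C)
    {x : ι → ℂ} (hx : ∀ i, ‖x i‖ ≤ 1 / 4) :
    ∑ q ∈ S, ‖c {q} + ∑ p ∈ S.erase q, x p * c {p, q}‖ ≤ 4 * C := by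
  suffices h : 1 / 4 * ∑ q ∈ S, ‖c {q} + ∑ p ∈ S.erase q, x p * c {p, q}‖ ≤ C by linarith
  refine sum_norm_le_of_forall_norm_sum_le (by norm_num) fun y hy => ?_
  have hadd := hC (fun i => x i + y i) fun i =>
    (norm_add_le _ _).trans (by linarith [hx i, hy i])
  have hsub := hC (fun i => x i - y i) fun i =>
    (norm_sub_le _ _).trans (by linarith [hx i, hy i])
  have hpol := (norm_sub_le _ _).trans (add_le_add hadd hsub)
  rw [sum_powerset_polarization hc, norm_mul, Complex.norm_ofNat] at hpol
  linarith

lemma sum_norm_singleton_le (hc : ∀ A ⊆ S, 2 < A.card → c A = 0)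
    (hC : ∀ l : ι → ℂ, (∀ i, ‖l i‖ ≤ 1 / 2) → ‖∑ A ∈ S.powerset, (∏ i ∈ A, l i) * c A‖ ≤ C) :
    ∑ q ∈ S, ‖c {q}‖ ≤ 4 * C := by
  classical
  simpa using sum_norm_add_sum_le hc hC (x := 0) (by simp)

lemma sum_norm_sum_pair_le [DecidableEq ι] (hc : ∀ A ⊆ S, 2 < A.card → c A = 0)
    (hC : ∀ l : ι → ℂ, (∀ i, ‖l i‖ ≤ 1 / 2) → ‖∑ A ∈ S.powerset, (∏ i ∈ A, l i) * c A‖ ≤ C)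
    {x : ι → ℂ} (hx : ∀ i, ‖x i‖ ≤ 1) :
    ∑ q ∈ S, ‖∑ p ∈ S.erase q, x p * c {p, q}‖ ≤ 32 * C := by
  have hquarter := sum_norm_add_sum_le hc hC (x := fun i => x i / 4) fun i => by
    rw [norm_div, Complex.norm_ofNat]
    linarith [hx i]
  have hterm : ∀ q ∈ S, ‖∑ p ∈ S.erase q, x p * c {p, q}‖ ≤
      4 * (‖c {q} + ∑ p ∈ S.erase q, x p / 4 * c {p, q}‖ + ‖c {q}‖) := fun q _ => by
    have : ∑ p ∈ S.erase q, x p * c {p, q} =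
        4 * (c {q} + ∑ p ∈ S.erase q, x p / 4 * c {p, q} - c {q}) := by
      rw [add_sub_cancel_left, Finset.mul_sum]
      exact Finset.sum_congr rfl fun p _ => by ring
    rw [this, norm_mul, Complex.norm_ofNat]
    gcongr
    exact norm_sub_le _ _
  refine (Finset.sum_le_sum hterm).trans ?_
  rw [← Finset.mul_sum, Finset.sum_add_distrib]
  linarith [sum_norm_singleton_le hc hC]

theorem sum_sqrt_sum_pair_sq_le [DecidableEq ι] (hc : ∀ A ⊆ S, 2 < A.card → c A = 0)
    (hC : ∀ l : ι → ℂ, (∀ i, ‖l i‖ ≤ 1 / 2) → ‖∑ A ∈ S.powerset, (∏ i ∈ A, l i) * c A‖ ≤ C) :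
    ∑ q ∈ S, √(∑ p ∈ S.erase q, ‖c {p, q}‖ ^ 2) ≤ 9 / 5 * (32 * C) := by
  have h := sum_sqrt_sum_norm_sq_le (S := S) (T := S)
    (c := fun p q => if p = q then 0 else c {p, q}) (K := 32 * C) fun x hx => by
      convert sum_norm_sum_pair_le hc hC hx using 3 with q
      rw [← Finset.filter_ne', Finset.sum_filter]
      exact Finset.sum_congr rfl fun p _ => by split_ifs <;> simp_all
  convert h using 3 with q
  rw [← Finset.filter_ne', Finset.sum_filter]
  exact Finset.sum_congr rfl fun p _ => by split_ifs <;> simp_all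

end DegreeTwo

section Optimality

lemma card_le_cardFactors_prod {A : Finset ℕ} (hA : ∀ n ∈ A, 1 < n) : A.card ≤ Ω (∏ n ∈ A, n) := by
  induction A using Finset.induction_on with
  | empty => simp
  | insert a A ha ih =>
    have ha1 : 1 < a := hA a (Finset.mem_insert_self a A)
    have hA1 : ∀ n ∈ A, 1 < n := fun n hn => hA n (Finset.mem_insert_of_mem hn)
    have hprod : ∏ n ∈ A, n ≠ 0 := Finset.prod_ne_zero_iff.2 fun n hn => (hA1 n hn).ne_bot
    have hpos := ArithmeticFunction.cardFactors_pos_iff_one_lt.2 ha1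
    rw [Finset.card_insert_of_notMem ha, Finset.prod_insert ha,
      ArithmeticFunction.cardFactors_mul ha1.ne_bot hprod]
    linarith [ih hA1]

section BoundedSeries

variable {b : ℕ → ℂ} {η C : ℝ} {S : Finset ℕ}

theorem norm_sum_powerset_mul_le_of_bounded (hη : 0 < η)
    (hbd : ∀ s : ℂ, -η < s.re → ∃ l, DirichletConvergesTo b s l ∧ ‖l‖ ≤ C)
    (hS : ∀ n ∈ S, 1 < n) (hco : (S : Set ℕ).Pairwise Nat.Coprime) {l : ℕ → ℂ}
    (hl : ∀ n, ‖l n‖ ≤ 1 / 2) : ‖∑ A ∈ S.powerset, (∏ n ∈ A, l n) * b (∏ n ∈ A, n)‖ ≤ C := by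
  choose! f hf hfC using hbd
  exact norm_sum_powerset_mul_le (F := fun t => f (t * Complex.I))
    (fun r hr => hasMean_mul_ratChar hη hf hfC hr) (fun t => hfC _ (by simpa using hη)) hS hco hl

lemma apply_prod_eq_zero_of_two_lt_card (hb : ∀ n, 2 < Ω n → b n = 0) (hS : ∀ n ∈ S, 1 < n) :
    ∀ A ⊆ S, 2 < A.card → b (∏ n ∈ A, n) = 0 := fun _ hA hcard =>
  hb _ (hcard.trans_le (card_le_cardFactors_prod fun n hn => hS n (hA hn)))

theorem sum_norm_le_of_bounded (hη : 0 < η)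
    (hbd : ∀ s : ℂ, -η < s.re → ∃ l, DirichletConvergesTo b s l ∧ ‖l‖ ≤ C)
    (hb : ∀ n, 2 < Ω n → b n = 0) (hS : ∀ n ∈ S, 1 < n)
    (hco : (S : Set ℕ).Pairwise Nat.Coprime) : ∑ n ∈ S, ‖b n‖ ≤ 4 * C := by
  simpa using sum_norm_singleton_le (apply_prod_eq_zero_of_two_lt_card hb hS)
    fun l hl => norm_sum_powerset_mul_le_of_bounded hη hbd hS hco hl

theorem sum_norm_sq_le_of_bounded (hη : 0 < η)
    (hbd : ∀ s : ℂ, -η < s.re → ∃ l, DirichletConvergesTo b s l ∧ ‖l‖ ≤ C)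
    (hb : ∀ n, 2 < Ω n → b n = 0) (hS : ∀ n ∈ S, 1 < n)
    (hco : (S : Set ℕ).Pairwise Nat.Coprime) : ∑ n ∈ S, ‖b (n ^ 2)‖ ≤ 4 * C := by
  have hinj : Function.Injective (· ^ 2 : ℕ → ℕ) := Nat.pow_left_injective two_ne_zero
  rw [← Finset.sum_image (f := fun n => ‖b n‖) hinj.injOn]
  refine sum_norm_le_of_bounded hη hbd hb ?_ ?_
  · simpa using fun n hn => Nat.one_lt_pow two_ne_zero (hS n hn)
  · rw [Finset.coe_image, hinj.injOn.pairwise_image]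
    exact fun m hm n hn hmn => (hco hm hn hmn).pow 2 2

theorem sum_sqrt_sum_mul_sq_le_of_bounded (hη : 0 < η)
    (hbd : ∀ s : ℂ, -η < s.re → ∃ l, DirichletConvergesTo b s l ∧ ‖l‖ ≤ C)
    (hb : ∀ n, 2 < Ω n → b n = 0) (hS : ∀ n ∈ S, 1 < n)
    (hco : (S : Set ℕ).Pairwise Nat.Coprime) :
    ∑ q ∈ S, √(∑ p ∈ S.erase q, ‖b (p * q)‖ ^ 2) ≤ 9 / 5 * (32 * C) := by
  convert sum_sqrt_sum_pair_sq_le (apply_prod_eq_zero_of_two_lt_card hb hS)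
    (fun l hl => norm_sum_powerset_mul_le_of_bounded hη hbd hS hco hl) using 5 with q _ p hp
  rw [Finset.prod_pair (Finset.ne_of_mem_erase hp)]

end BoundedSeries

lemma sum_Icc_inv_sqrt_le (N : ℕ) : ∑ m ∈ Finset.Icc 1 N, (√(m : ℝ))⁻¹ ≤ 2 * √(N : ℝ) := by
  induction N with
  | zero => simp
  | succ N ih =>
    have hsucc : √((N + 1 : ℕ) : ℝ) ^ 2 = √(N : ℝ) ^ 2 + 1 := by
      rw [Real.sq_sqrt (by positivity), Real.sq_sqrt (by positivity), Nat.cast_succ]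
    have hstep : (√((N + 1 : ℕ) : ℝ))⁻¹ ≤ 2 * √((N + 1 : ℕ) : ℝ) - 2 * √(N : ℝ) := by
      rw [inv_le_iff_one_le_mul₀ (Real.sqrt_pos.2 (by positivity))]
      nlinarith [sq_nonneg (√((N + 1 : ℕ) : ℝ) - √(N : ℝ))]
    rw [Finset.sum_Icc_succ_top (by omega)]
    linarith

lemma sum_lt_div_rpow_le {S : Finset ℕ} (hS : ∀ p ∈ S, 0 < p) {q : ℕ} (hq : 0 < q) (v : ℕ → ℝ) :
    ∑ p ∈ S with p < q, v p / ((p * q : ℕ) : ℝ) ^ (1 / 4 : ℝ) ≤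
      √2 * √(∑ p ∈ S with p < q, v p ^ 2) := by
  have hq' : (0 : ℝ) < q := by exact_mod_cast hq
  have hinv : ∑ p ∈ S with p < q, (((p : ℝ) ^ (1 / 4 : ℝ))⁻¹) ^ 2 ≤ 2 * √(q : ℝ) := by
    refine le_trans ?_ (sum_Icc_inv_sqrt_le q)
    calc _ = ∑ p ∈ S with p < q, (√(p : ℝ))⁻¹ := Finset.sum_congr rfl fun p _ => by
          rw [inv_pow, ← Real.rpow_natCast, ← Real.rpow_mul (by positivity), Real.sqrt_eq_rpow]
          norm_num
      _ ≤ _ := Finset.sum_le_sum_of_subset_of_nonneg (fun p hp => by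
          obtain ⟨hpS, hpq⟩ := Finset.mem_filter.1 hp
          exact Finset.mem_Icc.2 ⟨hS p hpS, hpq.le⟩) fun _ _ _ => by positivity
  have hsqrt : √(2 * √(q : ℝ)) * ((q : ℝ) ^ (1 / 4 : ℝ))⁻¹ = √2 := by
    rw [Real.sqrt_mul (by norm_num), Real.sqrt_eq_rpow (√(q : ℝ)), Real.sqrt_eq_rpow (q : ℝ),
      ← Real.rpow_mul hq'.le, ← Real.rpow_neg hq'.le, mul_assoc, ← Real.rpow_add hq']
    norm_num
  calc _ = (∑ p ∈ S with p < q, v p * ((p : ℝ) ^ (1 / 4 : ℝ))⁻¹) *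
          ((q : ℝ) ^ (1 / 4 : ℝ))⁻¹ := by
        rw [Finset.sum_mul]
        refine Finset.sum_congr rfl fun p _ => ?_
        rw [Nat.cast_mul, Real.mul_rpow (by positivity) (by positivity), div_eq_mul_inv, mul_inv,
          mul_assoc]
    _ ≤ √(∑ p ∈ S with p < q, v p ^ 2) * √(2 * √(q : ℝ)) * ((q : ℝ) ^ (1 / 4 : ℝ))⁻¹ := by
        gcongr
        exact (Real.sum_mul_le_sqrt_mul_sqrt _ _ _).trans (by gcongr)
    _ = _ := by rw [mul_assoc, hsqrt, mul_comm]

theorem sum_sum_lt_norm_div_rpow_le_of_bounded {b : ℕ → ℂ} {η C : ℝ} {S : Finset ℕ} (hη : 0 < η)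
    (hbd : ∀ s : ℂ, -η < s.re → ∃ l, DirichletConvergesTo b s l ∧ ‖l‖ ≤ C)
    (hb : ∀ n, 2 < Ω n → b n = 0) (hS : ∀ n ∈ S, 1 < n)
    (hco : (S : Set ℕ).Pairwise Nat.Coprime) :
    ∑ q ∈ S, ∑ p ∈ S with p < q, ‖b (p * q)‖ / ((p * q : ℕ) : ℝ) ^ (1 / 4 : ℝ) ≤
      √2 * (9 / 5 * (32 * C)) :=
  calc _ ≤ ∑ q ∈ S, √2 * √(∑ p ∈ S.erase q, ‖b (p * q)‖ ^ 2) := by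
        have hpos : ∀ n ∈ S, 0 < n := fun n hn => zero_lt_one.trans (hS n hn)
        refine Finset.sum_le_sum fun q hq => ?_
        refine (sum_lt_div_rpow_le hpos (hpos q hq) _).trans ?_
        gcongr
        exact fun p hp => Finset.mem_erase.2
          ⟨(Finset.mem_filter.1 hp).2.ne, (Finset.mem_filter.1 hp).1⟩
    _ ≤ _ := by
        rw [← Finset.mul_sum]
        gcongr
        exact sum_sqrt_sum_mul_sq_le_of_bounded hη hbd hb hS hco

lemma exists_mul_eq_of_cardFactors_le_two {n : ℕ} (hn : n ≠ 0) (h : Ω n ≤ 2) :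
    ∃ p q, (p = 1 ∨ p.Prime) ∧ (q = 1 ∨ q.Prime) ∧ p ≤ q ∧ p * q = n := by
  obtain rfl | hn1 := eq_or_ne n 1
  · exact ⟨1, 1, by simp⟩
  obtain ⟨p, hp, m, rfl⟩ := Nat.exists_prime_and_dvd hn1
  have hm : m = 1 ∨ m.Prime := by
    rw [ArithmeticFunction.cardFactors_mul hp.ne_zero (right_ne_zero_of_mul hn),
      ArithmeticFunction.cardFactors_apply_prime hp] at h
    obtain h0 | h1 : Ω m = 0 ∨ Ω m = 1 := by omega
    · exact Or.inl ((ArithmeticFunction.cardFactors_eq_zero_iff_eq_zero_or_one.1 h0).resolve_left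
        (right_ne_zero_of_mul hn))
    · exact Or.inr (ArithmeticFunction.cardFactors_eq_one_iff_prime.1 h1)
  obtain hpm | hmp := le_total p m
  · exact ⟨p, m, Or.inr hp, hm, hpm, rfl⟩
  · exact ⟨m, p, hm, Or.inr hp, hmp, mul_comm m p⟩

lemma filter_ne_zero_subset_image_mul {g : ℕ → ℝ} (hg0 : g 0 = 0)
    (hgΩ : ∀ n, 2 < Ω n → g n = 0) (N : ℕ) :
    {n ∈ Finset.range N | g n ≠ 0} ⊆
      ((insert 1 ((Finset.range N).filter Nat.Prime) ×ˢ
        insert 1 ((Finset.range N).filter Nat.Prime)).filter fun x => x.1 ≤ x.2).image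
          fun x => x.1 * x.2 := by
  intro n hn
  obtain ⟨hnN, hgn⟩ := Finset.mem_filter.1 hn
  have hn0 : n ≠ 0 := fun h => hgn (h ▸ hg0)
  obtain ⟨p, q, hp, hq, hpq, rfl⟩ :=
    exists_mul_eq_of_cardFactors_le_two hn0 (not_lt.1 fun h => hgn (hgΩ n h))
  have hmem : ∀ m, m = 1 ∨ m.Prime → m ∣ p * q →
      m ∈ insert 1 ((Finset.range N).filter Nat.Prime) := fun m hm hdvd =>
    Finset.mem_insert.2 (hm.imp_right fun hm' => Finset.mem_filter.2 ⟨Finset.mem_range.2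
      ((Nat.le_of_dvd (Nat.pos_of_ne_zero hn0) hdvd).trans_lt (Finset.mem_range.1 hnN)), hm'⟩)
  exact Finset.mem_image.2 ⟨(p, q), Finset.mem_filter.2 ⟨Finset.mem_product.2
    ⟨hmem p hp (dvd_mul_right p q), hmem q hq (dvd_mul_left q p)⟩, hpq⟩, rfl⟩

lemma sum_range_le_of_cardFactors_le_two {g : ℕ → ℝ} (hg : ∀ n, 0 ≤ g n) (hg0 : g 0 = 0)
    (hgΩ : ∀ n, 2 < Ω n → g n = 0) (N : ℕ) :
    ∑ n ∈ Finset.range N, g n ≤ g 1 + ∑ q ∈ Finset.range N with q.Prime,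
      (g q + (g (q ^ 2) + ∑ p ∈ (Finset.range N).filter Nat.Prime with p < q, g (p * q))) := by
  set S := (Finset.range N).filter Nat.Prime
  have h1S : 1 ∉ S := fun h => Nat.not_prime_one (Finset.mem_filter.1 h).2
  have hdiag : ∀ q ∈ S, (insert 1 S).filter (· ≤ q) = insert 1 (insert q {p ∈ S | p < q}) := by
    intro q hq
    have := (Finset.mem_filter.1 hq).2.one_lt
    grind
  calc ∑ n ∈ Finset.range N, g n
      ≤ ∑ x ∈ (insert 1 S ×ˢ insert 1 S).filter (fun x => x.1 ≤ x.2), g (x.1 * x.2) := by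
        have hcover := filter_ne_zero_subset_image_mul hg0 hgΩ N
        rw [← Finset.sum_filter_ne_zero]
        exact (Finset.sum_le_sum_of_subset_of_nonneg hcover fun n _ _ => hg n).trans
          (Finset.sum_image_le_of_nonneg fun _ _ => hg _)
    _ = ∑ q ∈ insert 1 S, ∑ p ∈ insert 1 S with p ≤ q, g (p * q) := by
        simp only [Finset.sum_filter, Finset.sum_product_right]
    _ = _ := by
        rw [Finset.sum_insert h1S]
        congr 1
        · rw [show (insert 1 S).filter (· ≤ 1) = {1} by
            have : ∀ p ∈ S, 1 < p := fun p hp => (Finset.mem_filter.1 hp).2.one_lt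
            grind, Finset.sum_singleton, one_mul]
        · refine Finset.sum_congr rfl fun q hq => ?_
          have hq1 := (Finset.mem_filter.1 hq).2.ne_one
          rw [hdiag q hq, Finset.sum_insert (by simp [hq1.symm, h1S]),
            Finset.sum_insert (by simp), one_mul, sq]

theorem lSeriesSummable_of_bounded_of_cardFactors_le_two {b : ℕ → ℂ} {η C : ℝ} (hη : 0 < η)
    (hb : ∀ n, 2 < Ω n → b n = 0)
    (hbd : ∀ s : ℂ, -η < s.re → ∃ l, DirichletConvergesTo b s l ∧ ‖l‖ ≤ C) :
    LSeriesSummable b (1 / 4 : ℝ) := by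
  set g : ℕ → ℝ := fun n => ‖LSeries.term b (1 / 4 : ℝ) n‖
  have hgn : ∀ n : ℕ, 0 < n → g n = ‖b n‖ / (n : ℝ) ^ (1 / 4 : ℝ) := fun n hn => by
    simp only [g, LSeries.norm_term_eq, if_neg hn.ne', Complex.ofReal_re]
  have hgb : ∀ n : ℕ, 0 < n → g n ≤ ‖b n‖ := fun n hn => by
    rw [hgn n hn]
    exact div_le_self (norm_nonneg _) (Real.one_le_rpow (by exact_mod_cast hn) (by norm_num))
  refine .of_norm (summable_of_sum_range_le
    (c := g 1 + (4 * C + (4 * C + √2 * (9 / 5 * (32 * C))))) (fun n => norm_nonneg _) fun N => ?_)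
  refine (sum_range_le_of_cardFactors_le_two (g := g) (fun n => norm_nonneg _) (by simp [g])
    (fun n hn => by simp [g, LSeries.norm_term_eq, hb n hn]) N).trans ?_
  set S := (Finset.range N).filter Nat.Prime
  have hS : ∀ p ∈ S, p.Prime := fun p hp => (Finset.mem_filter.1 hp).2
  have hco : (S : Set ℕ).Pairwise Nat.Coprime := fun p hp q hq hpq =>
    (Nat.coprime_primes (hS p hp) (hS q hq)).2 hpq
  have hlin : ∑ q ∈ S, g q ≤ 4 * C :=
    (Finset.sum_le_sum fun q hq => hgb q (hS q hq).pos).trans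
      (sum_norm_le_of_bounded hη hbd hb (fun q hq => (hS q hq).one_lt) hco)
  have hsq : ∑ q ∈ S, g (q ^ 2) ≤ 4 * C :=
    (Finset.sum_le_sum fun q hq => hgb _ (pow_pos (hS q hq).pos 2)).trans
      (sum_norm_sq_le_of_bounded hη hbd hb (fun q hq => (hS q hq).one_lt) hco)
  have hpair : ∑ q ∈ S, ∑ p ∈ S with p < q, g (p * q) ≤ √2 * (9 / 5 * (32 * C)) := by
    rw [Finset.sum_congr rfl fun q hq => Finset.sum_congr rfl fun p hp => hgn (p * q)
      (Nat.mul_pos (hS p (Finset.mem_filter.1 hp).1).pos (hS q hq).pos)]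
    exact sum_sum_lt_norm_div_rpow_le_of_bounded hη hbd hb (fun q hq => (hS q hq).one_lt) hco
  rw [Finset.sum_add_distrib, Finset.sum_add_distrib]
  gcongr

theorem abscissaOfAbsConv_le_abscissaOfBoundedness_add {a : ℕ → ℂ}
    (ha : ∀ n : ℕ, 2 < Ω n → a n = 0) :
    LSeries.abscissaOfAbsConv a ≤ abscissaOfBoundedness a + ((1 / 4 : ℝ) : EReal) := by
  rw [← EReal.sub_le_iff_le_add (by simp) (by simp)]
  refine le_sInf ?_
  rintro _ ⟨σ, ⟨C, hC⟩, rfl⟩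
  rw [EReal.sub_le_iff_le_add (by simp) (by simp), ← EReal.coe_add]
  refine LSeries.abscissaOfAbsConv_le_of_forall_lt_LSeriesSummable fun y hy => ?_
  have hsum : LSeriesSummable (fun n => a n * (n : ℂ) ^ (-((y - 1 / 4 : ℝ) : ℂ))) (1 / 4 : ℝ) := by
    refine lSeriesSummable_of_bounded_of_cardFactors_le_two (η := y - 1 / 4 - σ) (C := C)
      (by linarith) (fun n hn => by simp [ha n hn]) fun s hs => ?_
    simp only [dirichletConvergesTo_mul_cpow_iff]
    exact hC _ (by rw [Complex.add_re, Complex.ofReal_re]; linarith)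
  refine hsum.congr fun n => ?_
  obtain rfl | hn := eq_or_ne n 0
  · simp
  rw [LSeries.term_of_ne_zero hn, LSeries.term_of_ne_zero hn, Complex.cpow_neg, ← div_eq_mul_inv,
    div_div, ← Complex.cpow_add _ _ (Nat.cast_ne_zero.2 hn), ← Complex.ofReal_add,
    sub_add_cancel]

end Optimality

section Blocks

lemma prime_kthPrime (k : ℕ) : (kthPrime k).Prime := Nat.prime_nth_prime _

lemma monotone_kthPrime : Monotone kthPrime := fun _ _ h =>
  Nat.nth_monotone Nat.infinite_setOfPred_prime (Nat.sub_le_sub_right h 1)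

lemma strictMonoOn_kthPrime : StrictMonoOn kthPrime (Set.Ici 1) := fun k hk k' _ h =>
  Nat.nth_strictMono Nat.infinite_setOfPred_prime (by rw [Set.mem_Ici] at hk; omega)

lemma lt_kthPrime (k : ℕ) : k < kthPrime k := by
  have := Nat.add_two_le_nth_prime (k - 1)
  unfold kthPrime
  omega

lemma primeCounting_kthPrime {k : ℕ} (hk : 1 ≤ k) : Nat.primeCounting (kthPrime k) = k := by
  rw [Nat.primeCounting_eq_primeCounting'_succ, Nat.primeCounting', Nat.count_succ,
    if_pos (prime_kthPrime k), kthPrime, Nat.count_nth_of_infinite Nat.infinite_setOfPred_prime,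
    Nat.sub_add_cancel hk]

lemma kthPrime_mul_log_two_le {k : ℕ} (hk : 1 ≤ k) :
    kthPrime k * Real.log 2 ≤ 3 * k * Real.log (kthPrime k) := by
  set P := kthPrime k with hP
  have hP2 : (2 : ℝ) ≤ P := by exact_mod_cast (prime_kthPrime k).two_le
  have hk1 : (1 : ℝ) ≤ k := by exact_mod_cast hk
  have chebyshev := (Chebyshev.psi_ge P).trans (Chebyshev.psi_le_primeCounting_mul_log P)
  rw [hP, primeCounting_kthPrime hk, ← hP] at chebyshev
  have hlog_succ : Real.log (P + 1) ≤ 2 * Real.log P := by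
    rw [← Real.log_rpow (by linarith)]
    refine Real.log_le_log (by positivity) ?_
    rw [Real.rpow_two]
    nlinarith
  calc P * Real.log 2 ≤ (k + 2) * Real.log P := by linarith
    _ ≤ 3 * k * Real.log P := by
        gcongr
        linarith

lemma exists_kthPrime_rpow_le_mul {θ : ℝ} (hθ : θ < 1) :
    ∃ C : ℝ, 0 < C ∧ ∀ k : ℕ, 1 ≤ k → (kthPrime k : ℝ) ^ θ ≤ C * k := by
  have hθ' : 0 < 1 - θ := sub_pos.2 hθ
  refine ⟨3 / ((1 - θ) * Real.log 2), by positivity, fun k hk => ?_⟩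
  have hP : (0 : ℝ) < kthPrime k := by exact_mod_cast (prime_kthPrime k).pos
  have hlog : kthPrime k * Real.log 2 ≤ 3 * k * ((kthPrime k : ℝ) ^ (1 - θ) / (1 - θ)) :=
    (kthPrime_mul_log_two_le hk).trans (by gcongr; exact Real.log_le_rpow_div hP.le hθ')
  generalize (kthPrime k : ℝ) = P at *
  have hsplit : P = P ^ θ * P ^ (1 - θ) := by
    rw [← Real.rpow_add hP, add_sub_cancel, Real.rpow_one]
  rw [div_mul_eq_mul_div, le_div_iff₀ (by positivity)]
  refine le_of_mul_le_mul_right ?_ (Real.rpow_pos_of_pos hP (1 - θ))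
  calc P ^ θ * ((1 - θ) * Real.log 2) * P ^ (1 - θ)
      = (1 - θ) * (P ^ θ * P ^ (1 - θ) * Real.log 2) := by ring
    _ = (1 - θ) * (P * Real.log 2) := by rw [← hsplit]
    _ ≤ (1 - θ) * (3 * k * (P ^ (1 - θ) / (1 - θ))) := by
        gcongr
    _ = 3 * k * P ^ (1 - θ) := by field_simp

lemma exists_kthPrime_rpow_le {x y : ℝ} (hy : 0 < y) (hxy : x < y) :
    ∃ C : ℝ, 0 < C ∧ ∀ k : ℕ, 1 ≤ k → (kthPrime k : ℝ) ^ x ≤ C * (k : ℝ) ^ y := by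
  obtain ⟨C, hC, hle⟩ := exists_kthPrime_rpow_le_mul ((div_lt_one hy).2 hxy)
  refine ⟨C ^ y, by positivity, fun k hk => ?_⟩
  calc (kthPrime k : ℝ) ^ x = ((kthPrime k : ℝ) ^ (x / y)) ^ y := by
        rw [← Real.rpow_mul (by positivity), div_mul_cancel₀ _ hy.ne']
    _ ≤ (C * k) ^ y := Real.rpow_le_rpow (by positivity) (hle k hk) hy.le
    _ = C ^ y * (k : ℝ) ^ y := Real.mul_rpow hC.le (by positivity)

lemma eq_and_eq_of_prime_mul_eq {p q p' q' : ℕ} (hp : p.Prime) (hp' : p'.Prime) (hq' : q'.Prime)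
    (h : p < q) (h' : p' < q') (heq : p * q = p' * q') : p = p' ∧ q = q' := by
  rcases hp.dvd_mul.1 (heq ▸ dvd_mul_right p q) with hdvd | hdvd
  · obtain rfl := (Nat.prime_dvd_prime_iff_eq hp hp').1 hdvd
    exact ⟨rfl, Nat.eq_of_mul_eq_mul_left hp.pos heq⟩
  · obtain rfl := (Nat.prime_dvd_prime_iff_eq hp hq').1 hdvd
    rw [mul_comm p' p] at heq
    have := Nat.eq_of_mul_eq_mul_left hp.pos heq
    omega

lemma cardFactors_blockProduct (L i j : ℕ) : Ω (blockProduct L i j) = 2 := by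
  rw [blockProduct, ArithmeticFunction.cardFactors_mul (prime_kthPrime _).ne_zero
    (prime_kthPrime _).ne_zero, ArithmeticFunction.cardFactors_apply_prime (prime_kthPrime _),
    ArithmeticFunction.cardFactors_apply_prime (prime_kthPrime _)]

lemma lt_blockProduct (L i j : ℕ) : L < blockProduct L i j :=
  calc L < 2 ^ L := Nat.lt_two_pow_self
    _ ≤ 2 * 2 ^ L + i := by omega
    _ < kthPrime (2 * 2 ^ L + i) := lt_kthPrime _
    _ ≤ blockProduct L i j := Nat.le_mul_of_pos_right _ (prime_kthPrime _).pos

lemma blockProduct_mono_right (L i : ℕ) : Monotone (blockProduct L i) := fun _ _ h =>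
  Nat.mul_le_mul_left _ (monotone_kthPrime (by omega))

/-- The square of the `(4 * 2 ^ L)`-th prime, which separates consecutive blocks: the products
`blockProduct L i j` with `i, j < 2 ^ L` lie in `(blockBound (L - 1), blockBound L]`. -/
noncomputable def blockBound (L : ℕ) : ℕ := kthPrime (4 * 2 ^ L) ^ 2

lemma blockBound_pos (L : ℕ) : 0 < blockBound L := pow_pos (prime_kthPrime _).pos 2

lemma le_blockBound (L : ℕ) : L ≤ blockBound L :=
  calc L ≤ 4 * 2 ^ L := Nat.lt_two_pow_self.le.trans (by omega)
    _ ≤ kthPrime (4 * 2 ^ L) := (lt_kthPrime _).le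
    _ ≤ blockBound L := Nat.le_self_pow two_ne_zero _

lemma blockBound_mono : Monotone blockBound := fun _ _ h =>
  Nat.pow_le_pow_left (monotone_kthPrime (Nat.mul_le_mul_left _
    (Nat.pow_le_pow_right two_pos h))) 2

lemma blockProduct_le_blockBound {L i j : ℕ} (hi : i < 2 ^ L) (hj : j < 2 ^ L) :
    blockProduct L i j ≤ blockBound L := by
  rw [blockBound, sq]
  exact Nat.mul_le_mul (monotone_kthPrime (by omega)) (monotone_kthPrime (by omega))

lemma blockBound_lt_blockProduct {M L : ℕ} (h : M < L) (i j : ℕ) :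
    blockBound M < blockProduct L i j := by
  have hpow : 2 ^ M * 2 ≤ 2 ^ L := by
    rw [← Nat.pow_succ]
    exact Nat.pow_le_pow_right two_pos h
  have hM := Nat.two_pow_pos M
  rw [blockBound, sq]
  exact Nat.mul_lt_mul_of_le_of_lt (monotone_kthPrime (by omega))
    (strictMonoOn_kthPrime (Set.mem_Ici.2 (by omega)) (Set.mem_Ici.2 (by omega)) (by omega))
    (prime_kthPrime _).pos

lemma blockProduct_inj {L i j L' i' j' : ℕ} (hi : i < 2 ^ L) (hj : j < 2 ^ L) (hi' : i' < 2 ^ L')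
    (hj' : j' < 2 ^ L') (h : blockProduct L i j = blockProduct L' i' j') :
    L = L' ∧ i = i' ∧ j = j' := by
  have hL : L = L' := by
    rcases lt_trichotomy L L' with hlt | heq | hlt
    · have := (blockProduct_le_blockBound hi hj).trans_lt (blockBound_lt_blockProduct hlt i' j')
      omega
    · exact heq
    · have := (blockProduct_le_blockBound hi' hj').trans_lt (blockBound_lt_blockProduct hlt i j)
      omega
  subst hL
  have hpos (c : ℕ) : 2 * 2 ^ L + c ∈ Set.Ici 1 ∧ 3 * 2 ^ L + c ∈ Set.Ici 1 := by
    have := Nat.two_pow_pos L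
    simp only [Set.mem_Ici]
    omega
  obtain ⟨hp, hq⟩ := eq_and_eq_of_prime_mul_eq (prime_kthPrime _) (prime_kthPrime _)
    (prime_kthPrime _) (strictMonoOn_kthPrime (hpos i).1 (hpos j).2 (by omega))
    (strictMonoOn_kthPrime (hpos i').1 (hpos j').2 (by omega)) h
  have hi_eq := strictMonoOn_kthPrime.injOn (hpos i).1 (hpos i').1 hp
  have hj_eq := strictMonoOn_kthPrime.injOn (hpos j).2 (hpos j').2 hq
  omega

lemma exists_blockBound_rpow_le {x y : ℝ} (hy : 0 < y) (hxy : 2 * x < y) :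
    ∃ C : ℝ, 0 < C ∧ ∀ L : ℕ, (blockBound L : ℝ) ^ x ≤ C * ((2 : ℝ) ^ L) ^ y := by
  obtain ⟨C, hC, hle⟩ := exists_kthPrime_rpow_le hy hxy
  refine ⟨C * 4 ^ y, by positivity, fun L => ?_⟩
  calc (blockBound L : ℝ) ^ x = (kthPrime (4 * 2 ^ L) : ℝ) ^ (2 * x) := by
        rw [blockBound, Nat.cast_pow, ← Real.rpow_natCast, ← Real.rpow_mul (by positivity),
          Nat.cast_two]
    _ ≤ C * ((4 * 2 ^ L : ℕ) : ℝ) ^ y :=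
        hle _ (by have := Nat.two_pow_pos L; omega)
    _ = C * 4 ^ y * ((2 : ℝ) ^ L) ^ y := by
        push_cast
        rw [Real.mul_rpow (by norm_num) (by positivity), mul_assoc]

end Blocks

section WalshMatrix

lemma norm_walshEntry (r i j : ℕ) : ‖walshEntry r i j‖ = 1 := by
  rw [walshEntry, norm_pow, show (2 * Real.pi * Complex.I / r : ℂ) =
    ((2 * Real.pi / r : ℝ) : ℂ) * Complex.I by push_cast; ring, Complex.norm_exp_ofReal_mul_I,
    one_pow]

lemma conj_walshEntry (r i j : ℕ) : (starRingEnd ℂ) (walshEntry r i j) = (walshEntry r i j)⁻¹ := by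
  rw [Complex.inv_def, Complex.normSq_eq_norm_sq, norm_walshEntry]
  simp

lemma walshEntry_eq_pow_left (r i j : ℕ) : walshEntry r i j = walshEntry r i 1 ^ j := by
  rw [walshEntry, walshEntry, mul_one, pow_mul]

lemma walshEntry_eq_pow_right (r i j : ℕ) : walshEntry r i j = walshEntry r 1 j ^ i := by
  rw [walshEntry, walshEntry, one_mul, pow_mul']

lemma sum_walshEntry_mul_conj {r : ℕ} (hr : 0 < r) {j k : ℕ} (hj : j < r) (hk : k < r) :
    ∑ i ∈ Finset.range r, walshEntry r i j * (starRingEnd ℂ) (walshEntry r i k) =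
      if j = k then (r : ℂ) else 0 := by
  split_ifs with h
  · subst h
    simp [Complex.mul_conj', norm_walshEntry]
  set x := walshEntry r 1 j * (walshEntry r 1 k)⁻¹
  have hroot := Complex.isPrimitiveRoot_exp r hr.ne'
  have hone (m : ℕ) : walshEntry r 1 m ^ r = 1 := by
    rw [walshEntry, ← pow_mul, mul_comm (1 * m), pow_mul, hroot.pow_eq_one, one_pow]
  have hx : x ≠ 1 := by
    have hk0 : walshEntry r 1 k ≠ 0 := norm_ne_zero_iff.1 (by simp [norm_walshEntry])
    rw [Ne, mul_inv_eq_one₀ hk0, walshEntry, walshEntry, one_mul, one_mul]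
    exact fun heq => h (hroot.pow_inj hj hk heq)
  calc ∑ i ∈ Finset.range r, walshEntry r i j * (starRingEnd ℂ) (walshEntry r i k)
      = ∑ i ∈ Finset.range r, x ^ i := Finset.sum_congr rfl fun i _ => by
        rw [conj_walshEntry, walshEntry_eq_pow_right, walshEntry_eq_pow_right r i k, mul_pow,
          inv_pow]
    _ = 0 := by
        rw [geom_sum_eq hx, mul_pow, inv_pow, hone, hone, inv_one, mul_one, sub_self, zero_div]

lemma sum_norm_sum_walshEntry_sq {r : ℕ} (hr : 0 < r) (y : ℕ → ℂ) :
    ∑ i ∈ Finset.range r, ‖∑ j ∈ Finset.range r, walshEntry r i j * y j‖ ^ 2 =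
      r * ∑ j ∈ Finset.range r, ‖y j‖ ^ 2 := by
  rw [← Complex.ofReal_inj]
  push_cast
  simp only [← Complex.mul_conj', map_sum, map_mul, Finset.sum_mul_sum]
  rw [Finset.sum_comm, Finset.mul_sum]
  refine Finset.sum_congr rfl fun j hj => ?_
  rw [Finset.sum_comm]
  have hcolumns : ∀ k ∈ Finset.range r, ∑ i ∈ Finset.range r, walshEntry r i j * y j *
      ((starRingEnd ℂ) (walshEntry r i k) * (starRingEnd ℂ) (y k)) =
      if j = k then r * (y j * (starRingEnd ℂ) (y k)) else 0 := by
    intro k hk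
    rw [← zero_mul (y j * (starRingEnd ℂ) (y k)), ← ite_mul,
      ← sum_walshEntry_mul_conj hr (Finset.mem_range.1 hj) (Finset.mem_range.1 hk),
      Finset.sum_mul]
    exact Finset.sum_congr rfl fun i _ => by ring
  rw [Finset.sum_congr rfl hcolumns, Finset.sum_ite_eq, if_pos hj]

lemma norm_sum_sum_walshEntry_le {r : ℕ} (hr : 0 < r) (x y : ℕ → ℂ) :
    ‖∑ i ∈ Finset.range r, ∑ j ∈ Finset.range r, walshEntry r i j * (x i * y j)‖ ≤
      √(∑ i ∈ Finset.range r, ‖x i‖ ^ 2) * √(r * ∑ j ∈ Finset.range r, ‖y j‖ ^ 2) :=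
  calc ‖∑ i ∈ Finset.range r, ∑ j ∈ Finset.range r, walshEntry r i j * (x i * y j)‖
      = ‖∑ i ∈ Finset.range r, x i * ∑ j ∈ Finset.range r, walshEntry r i j * y j‖ := by
        simp only [Finset.mul_sum, mul_left_comm]
    _ ≤ ∑ i ∈ Finset.range r, ‖x i‖ * ‖∑ j ∈ Finset.range r, walshEntry r i j * y j‖ :=
        norm_sum_le_of_le _ fun i _ => (norm_mul _ _).le
    _ ≤ _ := by
        rw [← sum_norm_sum_walshEntry_sq hr]
        exact Real.sum_mul_le_sqrt_mul_sqrt _ _ _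

lemma sum_norm_sq_range_le {r : ℕ} {x : ℕ → ℂ} {X : ℝ} (hx : ∀ i < r, ‖x i‖ ≤ X) :
    ∑ i ∈ Finset.range r, ‖x i‖ ^ 2 ≤ r * X ^ 2 := by
  refine (Finset.sum_le_card_nsmul _ _ (X ^ 2) fun i hi => ?_).trans (by simp)
  exact pow_le_pow_left₀ (norm_nonneg _) (hx i (Finset.mem_range.1 hi)) 2

lemma norm_sum_sum_walshEntry_le_of_norm_le {r : ℕ} (hr : 0 < r) {x y : ℕ → ℂ} {X Y : ℝ}
    (hx : ∀ i < r, ‖x i‖ ≤ X) (hy : ∀ j < r, ‖y j‖ ≤ Y) :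
    ‖∑ i ∈ Finset.range r, ∑ j ∈ Finset.range r, walshEntry r i j * (x i * y j)‖ ≤
      (r : ℝ) ^ (3 / 2 : ℝ) * (X * Y) := by
  have hr0 : (0 : ℝ) < r := by exact_mod_cast hr
  have hX : 0 ≤ X := (norm_nonneg _).trans (hx 0 hr)
  have hY : 0 ≤ Y := (norm_nonneg _).trans (hy 0 hr)
  calc ‖∑ i ∈ Finset.range r, ∑ j ∈ Finset.range r, walshEntry r i j * (x i * y j)‖
      ≤ √(r * X ^ 2) * √(r * (r * Y ^ 2)) := by
        refine (norm_sum_sum_walshEntry_le hr x y).trans ?_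
        gcongr
        exacts [sum_norm_sq_range_le hx, sum_norm_sq_range_le hy]
    _ = √r * r * (X * Y) := by
        rw [← mul_assoc, ← sq, ← mul_pow, Real.sqrt_mul hr0.le, Real.sqrt_sq hX,
          Real.sqrt_sq (by positivity)]
        ring
    _ = (r : ℝ) ^ (3 / 2 : ℝ) * (X * Y) := by
        rw [Real.sqrt_eq_rpow, ← Real.rpow_add_one hr0.ne']
        norm_num

lemma two_mul_min_div_le_sin {x r : ℝ} (hx : 0 ≤ x) (hxr : x ≤ r) (hr : 0 < r) :
    2 * min x (r - x) / r ≤ Real.sin (Real.pi * x / r) := by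
  wlog h : x ≤ r / 2 generalizing x
  · have hsymm := this (x := r - x) (by linarith) (by linarith) (by linarith)
    rwa [sub_sub_cancel, min_comm, show Real.pi * (r - x) / r = Real.pi - Real.pi * x / r by
      field_simp, Real.sin_pi_sub] at hsymm
  have hpi := Real.pi_pos
  calc 2 * min x (r - x) / r ≤ 2 * x / r := by gcongr; exact min_le_left _ _
    _ = 2 / Real.pi * (Real.pi * x / r) := by field_simp
    _ ≤ Real.sin (Real.pi * x / r) := by
        refine Real.mul_le_sin (by positivity) ?_
        rw [div_le_div_iff₀ hr two_pos]
        nlinarith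

lemma norm_walshEntry_sub_one_ge {r i : ℕ} (hr : 0 < r) (hir : i ≤ r) :
    4 * min (i : ℝ) (r - i) / r ≤ ‖walshEntry r i 1 - 1‖ := by
  have hexp : walshEntry r i 1 = Complex.exp (Complex.I * (2 * (Real.pi * i / r) : ℝ)) := by
    rw [walshEntry, mul_one, ← Complex.exp_nat_mul]
    congr 1
    push_cast
    ring
  have hsin := two_mul_min_div_le_sin (Nat.cast_nonneg i) (Nat.cast_le.2 hir)
    (Nat.cast_pos.2 hr : (0 : ℝ) < r)
  rw [hexp, Complex.norm_exp_I_mul_ofReal_sub_one, mul_div_cancel_left₀ _ (two_ne_zero),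
    Real.norm_eq_abs, abs_mul, abs_two]
  calc 4 * min (i : ℝ) (r - i) / r = 2 * (2 * min (i : ℝ) (r - i) / r) := by ring
    _ ≤ 2 * |Real.sin (Real.pi * i / r)| := by
        gcongr
        exact hsin.trans (le_abs_self _)

lemma norm_sum_walshEntry_le {r i : ℕ} (hi : 1 ≤ i) (hir : i < r) (J : ℕ) :
    ‖∑ j ∈ Finset.range J, walshEntry r i j‖ ≤ r / 2 * ((i : ℝ)⁻¹ + ((r - i : ℕ) : ℝ)⁻¹) := by
  have hr0 : (0 : ℝ) < r := by exact_mod_cast hi.trans hir.le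
  have hd0 : (0 : ℝ) < r - i := sub_pos.2 (by exact_mod_cast hir)
  set x := walshEntry r i 1
  have hge : 4 * min (i : ℝ) (r - i) / r ≤ ‖x - 1‖ :=
    norm_walshEntry_sub_one_ge (by omega) hir.le
  have hne : x ≠ 1 := sub_ne_zero.1 (norm_pos_iff.1 (lt_of_lt_of_le (by positivity) hge))
  have hnum : ‖x ^ J - 1‖ ≤ 2 := by
    refine (norm_sub_le _ _).trans ?_
    rw [norm_pow, norm_walshEntry]
    norm_num
  calc ‖∑ j ∈ Finset.range J, walshEntry r i j‖ = ‖x ^ J - 1‖ / ‖x - 1‖ := by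
        rw [← norm_div, ← geom_sum_eq hne]
        simp only [x, ← walshEntry_eq_pow_left]
    _ ≤ 2 / (4 * min (i : ℝ) (r - i) / r) := by gcongr
    _ = r / 2 * (min (i : ℝ) (r - i))⁻¹ := by field_simp; norm_num
    _ ≤ r / 2 * ((i : ℝ)⁻¹ + ((r - i : ℕ) : ℝ)⁻¹) := by
        rw [Nat.cast_sub hir.le]
        gcongr
        rcases min_choice (i : ℝ) (r - i) with h | h <;> rw [h]
        · exact le_add_of_nonneg_right (by positivity)
        · exact le_add_of_nonneg_left (by positivity)

lemma sum_Ico_inv_le_one_add_log (r : ℕ) :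
    ∑ i ∈ Finset.Ico 1 r, (i : ℝ)⁻¹ ≤ 1 + Real.log r := by
  refine le_trans ?_ (harmonic_le_one_add_log r)
  rw [harmonic_eq_sum_Icc]
  push_cast
  exact Finset.sum_le_sum_of_subset_of_nonneg Finset.Ico_subset_Icc_self
    fun _ _ _ => by positivity

lemma norm_sum_staircase_le {r : ℕ} (hr : 0 < r) {J : ℕ → ℕ} (hJ : J 0 ≤ r) :
    ‖∑ i ∈ Finset.range r, ∑ j ∈ Finset.range (J i), walshEntry r i j‖ ≤
      r * (2 + Real.log r) := by
  have hfirst : ‖∑ j ∈ Finset.range (J 0), walshEntry r 0 j‖ ≤ r := by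
    refine (norm_sum_le _ _).trans ?_
    simp only [norm_walshEntry, Finset.sum_const, Finset.card_range, nsmul_eq_mul, mul_one]
    exact_mod_cast hJ
  have hothers : ∀ i ∈ Finset.Ico 1 r, ‖∑ j ∈ Finset.range (J i), walshEntry r i j‖ ≤
      r / 2 * ((i : ℝ)⁻¹ + ((r - i : ℕ) : ℝ)⁻¹) := fun i hi =>
    norm_sum_walshEntry_le (Finset.mem_Ico.1 hi).1 (Finset.mem_Ico.1 hi).2 _
  have hreflect : ∑ i ∈ Finset.Ico 1 r, ((r - i : ℕ) : ℝ)⁻¹ = ∑ i ∈ Finset.Ico 1 r, (i : ℝ)⁻¹ := by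
    simpa using Finset.sum_Ico_reflect (fun m : ℕ => (m : ℝ)⁻¹) 1 (Nat.le_succ r)
  rw [Finset.range_eq_Ico, Finset.sum_eq_sum_Ico_succ_bot hr]
  calc _ ≤ (r : ℝ) + ∑ i ∈ Finset.Ico 1 r, r / 2 * ((i : ℝ)⁻¹ + ((r - i : ℕ) : ℝ)⁻¹) :=
        (norm_add_le _ _).trans (add_le_add hfirst (norm_sum_le_of_le _ hothers))
    _ = r + r * ∑ i ∈ Finset.Ico 1 r, (i : ℝ)⁻¹ := by
        rw [← Finset.mul_sum, Finset.sum_add_distrib, hreflect]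
        ring
    _ ≤ r + r * (1 + Real.log r) := by gcongr; exact sum_Ico_inv_le_one_add_log r
    _ = r * (2 + Real.log r) := by ring

lemma exists_filter_range_eq_range {p : ℕ → Prop} [DecidablePred p] (hp : Antitone p) (r : ℕ) :
    ∃ J ≤ r, (Finset.range r).filter p = Finset.range J := by
  induction r with
  | zero => exact ⟨0, le_rfl, rfl⟩
  | succ r ih =>
    by_cases h : p r
    · exact ⟨r + 1, le_rfl, Finset.filter_true_of_mem fun j hj =>
        hp (Finset.mem_range_succ_iff.1 hj) h⟩
    · obtain ⟨J, hJ, hfilter⟩ := ih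
      exact ⟨J, by omega, by rw [Finset.range_add_one, Finset.filter_insert, if_neg h, hfilter]⟩

end WalshMatrix

section WalshCoefficients

/-- The weight `β L * 2 ^ (- 3 L / 2)` common to the coefficients of block `L`. -/
noncomputable def blockWeight (β : ℕ → ℂ) (L : ℕ) : ℂ :=
  β L * (((2 : ℝ) ^ (-(3 / 2 : ℝ) * (L : ℝ)) : ℝ) : ℂ)

lemma norm_blockWeight {β : ℕ → ℂ} {L : ℕ} (hβ : ‖β L‖ = 1) :
    ‖blockWeight β L‖ = ((2 : ℝ) ^ L) ^ (-(3 / 2) : ℝ) := by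
  rw [blockWeight, norm_mul, hβ, one_mul, Complex.norm_real, Real.norm_eq_abs,
    abs_of_pos (by positivity), mul_comm, Real.rpow_mul (by norm_num), Real.rpow_natCast]

lemma exists_of_walshCoeff_ne_zero {β : ℕ → ℂ} {n : ℕ} (h : walshCoeff β n ≠ 0) :
    ∃ L i j : ℕ, 1 ≤ L ∧ i < 2 ^ L ∧ j < 2 ^ L ∧ n = blockProduct L i j := by
  obtain ⟨L, hL, h⟩ := Finset.exists_ne_zero_of_sum_ne_zero h
  obtain ⟨i, hi, h⟩ := Finset.exists_ne_zero_of_sum_ne_zero h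
  obtain ⟨j, hj, h⟩ := Finset.exists_ne_zero_of_sum_ne_zero h
  refine ⟨L, i, j, (Finset.mem_Icc.1 hL).1, Finset.mem_range.1 hi, Finset.mem_range.1 hj, ?_⟩
  by_contra hne
  exact h (if_neg hne)

lemma cardFactors_of_walshCoeff_ne_zero {β : ℕ → ℂ} {n : ℕ} (h : walshCoeff β n ≠ 0) : Ω n = 2 := by
  obtain ⟨L, i, j, -, -, -, rfl⟩ := exists_of_walshCoeff_ne_zero h
  exact cardFactors_blockProduct L i j

lemma walshCoeff_blockProduct (β : ℕ → ℂ) {L i j : ℕ} (hL : 1 ≤ L) (hi : i < 2 ^ L)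
    (hj : j < 2 ^ L) :
    walshCoeff β (blockProduct L i j) = blockWeight β L * walshEntry (2 ^ L) i j := by
  have hne : ∀ L' i' j', i' < 2 ^ L' → j' < 2 ^ L' → (L' ≠ L ∨ i' ≠ i ∨ j' ≠ j) →
      blockProduct L i j ≠ blockProduct L' i' j' := fun L' i' j' hi' hj' h heq => by
    have := blockProduct_inj hi hj hi' hj' heq
    omega
  rw [walshCoeff, Finset.sum_eq_single_of_mem L (Finset.mem_Icc.2 ⟨hL, (lt_blockProduct L i j).le⟩),
    Finset.sum_eq_single_of_mem i (Finset.mem_range.2 hi),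
    Finset.sum_eq_single_of_mem j (Finset.mem_range.2 hj), if_pos rfl, blockWeight]
  · intro j' hj' h
    exact if_neg (hne _ _ _ hi (Finset.mem_range.1 hj') (Or.inr (Or.inr h)))
  · intro i' hi' h
    exact Finset.sum_eq_zero fun j' hj' => if_neg
      (hne _ _ _ (Finset.mem_range.1 hi') (Finset.mem_range.1 hj') (Or.inr (Or.inl h)))
  · intro L' _ h
    exact Finset.sum_eq_zero fun i' hi' => Finset.sum_eq_zero fun j' hj' => if_neg
      (hne _ _ _ (Finset.mem_range.1 hi') (Finset.mem_range.1 hj') (Or.inl h))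

end WalshCoefficients

section WalshSeries

/-- The contribution of block `L` to the sum of `walshCoeff β n * g n` over `n ≤ N`. -/
noncomputable def blockSum (β g : ℕ → ℂ) (N L : ℕ) : ℂ :=
  blockWeight β L * ∑ i ∈ Finset.range (2 ^ L), ∑ j ∈ Finset.range (2 ^ L),
    if blockProduct L i j ≤ N then walshEntry (2 ^ L) i j * g (blockProduct L i j) else 0

lemma blockSum_eq_zero (β g : ℕ → ℂ) {N L : ℕ} (h : ∀ i j, N < blockProduct L i j) :
    blockSum β g N L = 0 := by
  simp only [blockSum, (h _ _).not_ge, if_false, Finset.sum_const_zero, mul_zero]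

lemma blockSum_of_blockBound_le (β g : ℕ → ℂ) {N L : ℕ} (h : blockBound L ≤ N) :
    blockSum β g N L = blockWeight β L * ∑ i ∈ Finset.range (2 ^ L), ∑ j ∈ Finset.range (2 ^ L),
      walshEntry (2 ^ L) i j * g (blockProduct L i j) := by
  refine congrArg _ (Finset.sum_congr rfl fun i hi => Finset.sum_congr rfl fun j hj => if_pos ?_)
  exact (blockProduct_le_blockBound (Finset.mem_range.1 hi) (Finset.mem_range.1 hj)).trans h

lemma walshCoeff_mul_eq_sum (β g : ℕ → ℂ) {n N : ℕ} (h : n ≤ N) :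
    walshCoeff β n * g n =
      ∑ L ∈ Finset.Icc 1 N, ∑ i ∈ Finset.range (2 ^ L), ∑ j ∈ Finset.range (2 ^ L),
        if n = blockProduct L i j then
          blockWeight β L * (walshEntry (2 ^ L) i j * g (blockProduct L i j)) else 0 := by
  rw [← Finset.sum_subset (Finset.Icc_subset_Icc_right h), walshCoeff]
  · simp only [Finset.sum_mul]
    refine Finset.sum_congr rfl fun L _ => Finset.sum_congr rfl fun i _ =>
      Finset.sum_congr rfl fun j _ => ?_
    split_ifs with hn
    · rw [← hn, blockWeight, mul_assoc _ _ (g n)]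
    · exact zero_mul _
  · refine fun L hL hLn => Finset.sum_eq_zero fun i _ => Finset.sum_eq_zero fun j _ => if_neg ?_
    rintro rfl
    exact hLn (Finset.mem_Icc.2 ⟨(Finset.mem_Icc.1 hL).1, (lt_blockProduct L i j).le⟩)

lemma sum_walshCoeff_mul (β g : ℕ → ℂ) (N : ℕ) :
    ∑ n ∈ Finset.Icc 1 N, walshCoeff β n * g n = ∑ L ∈ Finset.Icc 1 N, blockSum β g N L := by
  rw [Finset.sum_congr rfl fun n hn => walshCoeff_mul_eq_sum β g (Finset.mem_Icc.1 hn).2,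
    Finset.sum_comm]
  refine Finset.sum_congr rfl fun L _ => ?_
  rw [Finset.sum_comm, blockSum, Finset.mul_sum]
  refine Finset.sum_congr rfl fun i _ => ?_
  rw [Finset.sum_comm, Finset.mul_sum]
  refine Finset.sum_congr rfl fun j _ => ?_
  have := lt_blockProduct L i j
  rw [Finset.sum_ite_eq', mul_ite, mul_zero]
  exact if_congr (by rw [Finset.mem_Icc]; omega) rfl rfl

lemma sum_walshCoeff_eq_tsum (β : ℕ → ℂ) (N : ℕ) :
    ∑ n ∈ Finset.Icc 1 N, walshCoeff β n = ∑' m, blockSum β 1 N (m + 1) := by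
  have hsum := sum_walshCoeff_mul β 1 N
  simp only [Pi.one_apply, mul_one] at hsum
  rw [hsum, tsum_eq_sum (s := Finset.range N), Finset.range_eq_Ico,
    Finset.sum_Ico_add' (blockSum β 1 N) 0 N 1]
  · rfl
  · intro m hm
    rw [Finset.mem_range] at hm
    exact blockSum_eq_zero β 1 fun i j => by
      have := lt_blockProduct (m + 1) i j
      omega

variable {β : ℕ → ℂ} {L : ℕ}

lemma norm_blockSum_one_le (hβ : ‖β L‖ = 1) (N : ℕ) :
    ‖blockSum β 1 N L‖ ≤ (2 + L) * ((2 : ℝ) ^ L) ^ (-(1 / 2) : ℝ) := by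
  have hpow : (0 : ℝ) < 2 ^ L := by positivity
  choose J hJ hfilter using fun i => exists_filter_range_eq_range
    (p := fun j => blockProduct L i j ≤ N)
    (fun _ _ h h' => (blockProduct_mono_right L i h).trans h') (2 ^ L)
  have hlog : Real.log ((2 ^ L : ℕ) : ℝ) ≤ L := by
    rw [Nat.cast_pow, Real.log_pow, Nat.cast_two]
    exact mul_le_of_le_one_right (by positivity) (Real.log_two_lt_d9.le.trans (by norm_num))
  have hstaircase := norm_sum_staircase_le (Nat.two_pow_pos L) (J := J) (hJ 0)
  simp only [blockSum, norm_mul, norm_blockWeight hβ, Pi.one_apply, mul_one, ← Finset.sum_filter,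
    hfilter]
  calc _ ≤ ((2 : ℝ) ^ L) ^ (-(3 / 2) : ℝ) * (((2 ^ L : ℕ) : ℝ) * (2 + L)) := by
        gcongr
        exact hstaircase.trans (by gcongr)
    _ = (2 + L) * (((2 : ℝ) ^ L) ^ (-(3 / 2) : ℝ) * ((2 : ℝ) ^ L) ^ (1 : ℝ)) := by
        rw [Real.rpow_one]
        push_cast
        ring
    _ = (2 + L) * ((2 : ℝ) ^ L) ^ (-(1 / 2) : ℝ) := by
        rw [← Real.rpow_add hpow]
        norm_num

lemma norm_blockSum_one_sub_le (hβ : ‖β L‖ = 1) {κ : ℝ} (hκ : 0 ≤ κ) {N : ℕ} (hN : 1 ≤ N) :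
    ‖blockSum β 1 (blockBound L) L - blockSum β 1 N L‖ ≤
      2 * ((2 + L) * ((2 : ℝ) ^ L) ^ (-(1 / 2) : ℝ) * (blockBound L : ℝ) ^ κ) *
        (N : ℝ) ^ (-κ) := by
  have hN0 : (0 : ℝ) < N := by exact_mod_cast hN
  rcases le_or_gt (blockBound L) N with hle | hlt
  · rw [blockSum_of_blockBound_le β 1 le_rfl, blockSum_of_blockBound_le β 1 hle, sub_self,
      norm_zero]
    positivity
  · have hone : 1 ≤ (blockBound L : ℝ) ^ κ * (N : ℝ) ^ (-κ) := by
      rw [Real.rpow_neg hN0.le, ← div_eq_mul_inv, one_le_div (by positivity)]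
      gcongr
    calc _ ≤ 2 * ((2 + L) * ((2 : ℝ) ^ L) ^ (-(1 / 2) : ℝ)) * 1 := by
          refine (norm_sub_le _ _).trans ?_
          linarith [norm_blockSum_one_le hβ (blockBound L), norm_blockSum_one_le hβ N]
      _ ≤ 2 * ((2 + L) * ((2 : ℝ) ^ L) ^ (-(1 / 2) : ℝ)) *
          ((blockBound L : ℝ) ^ κ * (N : ℝ) ^ (-κ)) := by gcongr
      _ = _ := by ring

lemma summable_blockBound_rpow {κ : ℝ} (hκ : κ < 1 / 4) :
    Summable fun L : ℕ =>
      (2 + (L : ℝ)) * ((2 : ℝ) ^ L) ^ (-(1 / 2) : ℝ) * (blockBound L : ℝ) ^ κ := by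
  obtain ⟨y, hy, hy2⟩ := exists_between (max_lt (by norm_num) (by linarith) : max 0 (2 * κ) < 1 / 2)
  obtain ⟨C, -, hC⟩ := exists_blockBound_rpow_le ((le_max_left _ _).trans_lt hy)
    ((le_max_right _ _).trans_lt hy)
  set ρ : ℝ := 2 ^ (-(1 / 2) + y)
  have hρ : ‖ρ‖ < 1 := by
    rw [Real.norm_of_nonneg (by positivity)]
    exact Real.rpow_lt_one_of_one_lt_of_neg one_lt_two (by linarith)
  have hgeom : Summable fun L : ℕ => C * ((2 + (L : ℝ)) * ρ ^ L) := by
    refine (((summable_geometric_of_norm_lt_one hρ).mul_left 2).add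
      (summable_pow_mul_geometric_of_norm_lt_one 1 hρ)).congr (fun L => ?_) |>.mul_left C
    rw [pow_one, add_mul]
  refine .of_nonneg_of_le (fun L => by positivity) (fun L => ?_) hgeom
  calc _ ≤ (2 + (L : ℝ)) * ((2 : ℝ) ^ L) ^ (-(1 / 2) : ℝ) * (C * ((2 : ℝ) ^ L) ^ y) := by
        gcongr
        exact hC L
    _ = C * ((2 + (L : ℝ)) * ρ ^ L) := by
        rw [Real.rpow_pow_comm two_pos.le, Real.rpow_add (by positivity)]
        ring

lemma exists_walshCoeff_tail_le (hβ : ∀ L, 1 ≤ L → ‖β L‖ = 1) {κ : ℝ} (hκ : 0 ≤ κ)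
    (hκ4 : κ < 1 / 4) :
    ∃ (R : ℕ → ℂ) (C : ℝ), (∀ n, 1 ≤ n → walshCoeff β n = R (n - 1) - R n) ∧
      ∀ n, 1 ≤ n → ‖R n‖ ≤ C * (n : ℝ) ^ (-κ) := by
  set u : ℕ → ℝ := fun L =>
    (2 + (L : ℝ)) * ((2 : ℝ) ^ L) ^ (-(1 / 2) : ℝ) * (blockBound L : ℝ) ^ κ
  set full : ℕ → ℂ := fun m => blockSum β 1 (blockBound (m + 1)) (m + 1)
  have hu : Summable fun m => u (m + 1) :=
    (summable_nat_add_iff 1).2 (summable_blockBound_rpow hκ4)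
  have hsummable (N : ℕ → ℕ) : Summable fun m => blockSum β 1 (N m) (m + 1) := by
    refine .of_norm_bounded hu fun m => (norm_blockSum_one_le (hβ _ m.succ_pos) _).trans ?_
    exact le_mul_of_one_le_right (by positivity)
      (Real.one_le_rpow (by exact_mod_cast blockBound_pos _) hκ)
  refine ⟨fun N => ∑' m, full m - ∑ n ∈ Finset.Icc 1 N, walshCoeff β n,
    2 * ∑' m, u (m + 1), fun n hn => ?_, fun N hN => ?_⟩
  · obtain ⟨m, rfl⟩ := Nat.exists_eq_add_of_le' hn
    simp only [Nat.add_sub_cancel, Finset.sum_Icc_succ_top hn]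
    ring
  · beta_reduce
    rw [sum_walshCoeff_eq_tsum, ← (hsummable _).tsum_sub (hsummable _)]
    exact tsum_of_norm_bounded ((hu.hasSum.mul_left 2).mul_right _) fun m =>
      norm_blockSum_one_sub_le (hβ _ m.succ_pos) hκ hN

theorem exists_dirichletConvergesTo_walshCoeff (hβ : ∀ L, 1 ≤ L → ‖β L‖ = 1) {s : ℂ}
    (hs : -(1 / 4) < s.re) : ∃ l, DirichletConvergesTo (walshCoeff β) s l := by
  obtain ⟨κ, hκ, hκ4⟩ := exists_between
    (max_lt (by norm_num) (by linarith) : max 0 (-s.re) < 1 / 4)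
  obtain ⟨R, C, hdiff, hR⟩ := exists_walshCoeff_tail_le hβ ((le_max_left _ _).trans hκ.le) hκ4
  exact ⟨_, dirichletConvergesTo_abel hdiff hR (by linarith)
    (by linarith [le_max_right 0 (-s.re)])⟩

theorem abscissaOfConv_walshCoeff_le (hβ : ∀ L, 1 ≤ L → ‖β L‖ = 1) :
    abscissaOfConv (walshCoeff β) ≤ ((-(1 / 4) : ℝ) : EReal) :=
  sInf_le ⟨_, fun _ hs => exists_dirichletConvergesTo_walshCoeff hβ hs, rfl⟩

lemma norm_kthPrime_cpow_neg_le {k : ℕ} {x σ : ℝ} {s : ℂ} (hx : 0 < x) (hxk : x ≤ k) (hσ : 0 ≤ σ)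
    (hs : σ ≤ s.re) : ‖(kthPrime k : ℂ) ^ (-s)‖ ≤ x ^ (-σ) := by
  have hpos := (prime_kthPrime k).pos
  have hxp : x ≤ kthPrime k := hxk.trans (by exact_mod_cast (lt_kthPrime k).le)
  rw [Complex.norm_natCast_cpow_of_pos hpos, Complex.neg_re]
  calc (kthPrime k : ℝ) ^ (-s.re) ≤ (kthPrime k : ℝ) ^ (-σ) :=
        Real.rpow_le_rpow_of_exponent_le (by exact_mod_cast hpos) (neg_le_neg hs)
    _ ≤ x ^ (-σ) := Real.rpow_le_rpow_of_nonpos hx hxp (neg_nonpos.2 hσ)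

lemma norm_blockSum_cpow_le (hβ : ‖β L‖ = 1) {σ : ℝ} (hσ : 0 ≤ σ) {s : ℂ} (hs : σ ≤ s.re) {N : ℕ}
    (hN : blockBound L ≤ N) :
    ‖blockSum β (fun n => (n : ℂ) ^ (-s)) N L‖ ≤ ((2 : ℝ) ^ (-σ)) ^ L := by
  have hpow : (0 : ℝ) < 2 ^ L := by positivity
  have hbilinear := norm_sum_sum_walshEntry_le_of_norm_le (Nat.two_pow_pos L)
    (x := fun i => (kthPrime (2 * 2 ^ L + i) : ℂ) ^ (-s))
    (y := fun j => (kthPrime (3 * 2 ^ L + j) : ℂ) ^ (-s))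
    (X := ((2 : ℝ) ^ L) ^ (-σ)) (Y := 1 ^ (-σ))
    (fun i _ => norm_kthPrime_cpow_neg_le hpow (by push_cast; nlinarith [i.cast_nonneg (α := ℝ)])
      hσ hs)
    (fun j _ => norm_kthPrime_cpow_neg_le one_pos
      (by exact_mod_cast (by have := Nat.two_pow_pos L; omega)) hσ hs)
  rw [Real.one_rpow, mul_one] at hbilinear
  simp only [blockSum_of_blockBound_le β _ hN, norm_mul, norm_blockWeight hβ, blockProduct,
    Nat.cast_mul, Complex.natCast_mul_natCast_cpow]
  calc _ ≤ ((2 : ℝ) ^ L) ^ (-(3 / 2) : ℝ) *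
        (((2 ^ L : ℕ) : ℝ) ^ (3 / 2 : ℝ) * ((2 : ℝ) ^ L) ^ (-σ)) := by gcongr
    _ = ((2 : ℝ) ^ L) ^ (-σ) := by
        push_cast
        rw [← mul_assoc, ← Real.rpow_add hpow, neg_add_cancel, Real.rpow_zero, one_mul]
    _ = ((2 : ℝ) ^ (-σ)) ^ L := (Real.rpow_pow_comm two_pos.le _ _).symm

lemma sum_walshCoeff_mul_blockBound (β g : ℕ → ℂ) (M : ℕ) :
    ∑ n ∈ Finset.Icc 1 (blockBound M), walshCoeff β n * g n =
      ∑ L ∈ Finset.Icc 1 M, blockSum β g (blockBound M) L := by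
  rw [sum_walshCoeff_mul, ← Finset.sum_subset (Finset.Icc_subset_Icc_right (le_blockBound M))]
  intro L hL hLM
  have hML : M < L := by
    rw [Finset.mem_Icc] at hL hLM
    omega
  exact blockSum_eq_zero β g (blockBound_lt_blockProduct hML)

lemma norm_le_of_dirichletConvergesTo_walshCoeff (hβ : ∀ L, 1 ≤ L → ‖β L‖ = 1) {σ : ℝ}
    (hσ : 0 < σ) {s : ℂ} (hs : σ ≤ s.re) {l : ℂ} (hl : DirichletConvergesTo (walshCoeff β) s l) :
    ‖l‖ ≤ (1 - (2 : ℝ) ^ (-σ))⁻¹ := by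
  have hρ0 : (0 : ℝ) ≤ 2 ^ (-σ) := by positivity
  have hρ1 : (2 : ℝ) ^ (-σ) < 1 := Real.rpow_lt_one_of_one_lt_of_neg one_lt_two (by linarith)
  have hsub : Tendsto blockBound atTop atTop := tendsto_atTop_mono le_blockBound tendsto_id
  refine le_of_tendsto (hl.comp hsub).norm (Eventually.of_forall fun M => ?_)
  rw [Function.comp_apply, sum_walshCoeff_mul_blockBound]
  calc _ ≤ ∑ L ∈ Finset.Icc 1 M, ((2 : ℝ) ^ (-σ)) ^ L := norm_sum_le_of_le _ fun L hL =>
        norm_blockSum_cpow_le (hβ L (Finset.mem_Icc.1 hL).1) hσ.le hs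
          (blockBound_mono (Finset.mem_Icc.1 hL).2)
    _ ≤ ∑' L : ℕ, ((2 : ℝ) ^ (-σ)) ^ L :=
        (summable_geometric_of_lt_one hρ0 hρ1).sum_le_tsum _ fun _ _ => by positivity
    _ = (1 - (2 : ℝ) ^ (-σ))⁻¹ := tsum_geometric_of_lt_one hρ0 hρ1

theorem abscissaOfBoundedness_walshCoeff_le (hβ : ∀ L, 1 ≤ L → ‖β L‖ = 1) :
    abscissaOfBoundedness (walshCoeff β) ≤ 0 := by
  refine EReal.le_of_forall_lt_iff_le.1 fun σ hσ => sInf_le ⟨σ, ?_, rfl⟩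
  have hσ0 : 0 < σ := by exact_mod_cast hσ
  refine ⟨(1 - (2 : ℝ) ^ (-σ))⁻¹, fun s hs => ?_⟩
  obtain ⟨l, hl⟩ := exists_dirichletConvergesTo_walshCoeff hβ (s := s) (by linarith)
  exact ⟨l, hl, norm_le_of_dirichletConvergesTo_walshCoeff hβ hσ0 hs.le hl⟩

lemma two_pow_sq_mul_le_tsum_of_forall_le {g : ℕ → ℝ} (hg : Summable g) (hg0 : ∀ n, 0 ≤ g n)
    {c : ℝ} (hc : ∀ i < 2 ^ L, ∀ j < 2 ^ L, c ≤ g (blockProduct L i j)) :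
    ((2 : ℝ) ^ L) ^ 2 * c ≤ ∑' n, g n := by
  set S : Finset (ℕ × ℕ) := Finset.range (2 ^ L) ×ˢ Finset.range (2 ^ L)
  have hmem {x : ℕ × ℕ} (hx : x ∈ S) : x.1 < 2 ^ L ∧ x.2 < 2 ^ L := by
    simpa only [S, Finset.mem_product, Finset.mem_range] using hx
  have hinj : Set.InjOn (fun x : ℕ × ℕ => blockProduct L x.1 x.2) S := fun x hx x' hx' h => by
    obtain ⟨-, h₁, h₂⟩ := blockProduct_inj (hmem hx).1 (hmem hx).2 (hmem hx').1 (hmem hx').2 h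
    exact Prod.ext h₁ h₂
  calc ((2 : ℝ) ^ L) ^ 2 * c = ∑ _x ∈ S, c := by
        rw [Finset.sum_const, Finset.card_product, Finset.card_range, nsmul_eq_mul, sq]
        push_cast
        rfl
    _ ≤ ∑ x ∈ S, g (blockProduct L x.1 x.2) :=
        Finset.sum_le_sum fun x hx => hc _ (hmem hx).1 _ (hmem hx).2
    _ = ∑ n ∈ S.image fun x : ℕ × ℕ => blockProduct L x.1 x.2, g n := (Finset.sum_image hinj).symm
    _ ≤ ∑' n, g n := hg.sum_le_tsum _ fun n _ => hg0 n

lemma le_norm_term_walshCoeff_blockProduct (hL : 1 ≤ L) (hβ : ‖β L‖ = 1) {y : ℝ} (hy : 0 ≤ y)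
    {i j : ℕ} (hi : i < 2 ^ L) (hj : j < 2 ^ L) :
    ((2 : ℝ) ^ L) ^ (-(3 / 2) : ℝ) * (blockBound L : ℝ) ^ (-y) ≤
      ‖LSeries.term (walshCoeff β) y (blockProduct L i j)‖ := by
  have hpos : 0 < blockProduct L i j := (Nat.zero_le _).trans_lt (lt_blockProduct L i j)
  have hle : (blockProduct L i j : ℝ) ≤ blockBound L := by
    exact_mod_cast blockProduct_le_blockBound hi hj
  rw [LSeries.term_of_ne_zero hpos.ne', walshCoeff_blockProduct β hL hi hj, norm_div, norm_mul,
    norm_walshEntry, mul_one, norm_blockWeight hβ, Complex.norm_natCast_cpow_of_pos hpos,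
    Complex.ofReal_re, div_eq_mul_inv _ (_ ^ y), ← Real.rpow_neg (by positivity)]
  gcongr ?_ * ?_
  exact Real.rpow_le_rpow_of_nonpos (by exact_mod_cast hpos) hle (neg_nonpos.2 hy)

lemma two_pow_rpow_half_le_of_lseriesSummable (hL : 1 ≤ L) (hβ : ‖β L‖ = 1) {y : ℝ} (hy : 0 ≤ y)
    (h : LSeriesSummable (walshCoeff β) y) :
    ((2 : ℝ) ^ L) ^ (1 / 2 : ℝ) ≤
      (blockBound L : ℝ) ^ y * ∑' n, ‖LSeries.term (walshCoeff β) y n‖ := by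
  have hpow : (0 : ℝ) < 2 ^ L := by positivity
  have hbound : (0 : ℝ) < blockBound L := by exact_mod_cast blockBound_pos L
  have hblock := two_pow_sq_mul_le_tsum_of_forall_le h.norm (fun _ => norm_nonneg _)
    fun _ hi _ hj => le_norm_term_walshCoeff_blockProduct hL hβ hy hi hj
  rw [← mul_assoc, ← Real.rpow_two, ← Real.rpow_add hpow, Real.rpow_neg hbound.le,
    ← div_eq_mul_inv, div_le_iff₀' (by positivity)] at hblock
  norm_num at hblock ⊢
  exact hblock

theorem not_lseriesSummable_walshCoeff (hβ : ∀ L, 1 ≤ L → ‖β L‖ = 1) {y : ℝ} (hy : 0 ≤ y)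
    (hy4 : y < 1 / 4) : ¬LSeriesSummable (walshCoeff β) y := fun h => by
  obtain ⟨μ, hyμ, hμ⟩ := exists_between (by linarith : 2 * y < 1 / 2)
  obtain ⟨C, -, hC⟩ := exists_blockBound_rpow_le (by linarith) hyμ
  set T : ℝ := ∑' n, ‖LSeries.term (walshCoeff β) y n‖
  have hbounded : ∀ L : ℕ, 1 ≤ L → ((2 : ℝ) ^ L) ^ (1 / 2 - μ) ≤ C * T := fun L hL => by
    rw [Real.rpow_sub (by positivity), div_le_iff₀ (by positivity)]
    calc ((2 : ℝ) ^ L) ^ (1 / 2 : ℝ) ≤ (blockBound L : ℝ) ^ y * T :=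
          two_pow_rpow_half_le_of_lseriesSummable hL (hβ L hL) hy h
      _ ≤ C * ((2 : ℝ) ^ L) ^ μ * T := by
          gcongr
          exact hC L
      _ = C * T * ((2 : ℝ) ^ L) ^ μ := by ring
  have hunbounded : Tendsto (fun L : ℕ => ((2 : ℝ) ^ L) ^ (1 / 2 - μ)) atTop atTop :=
    (tendsto_rpow_atTop (by linarith)).comp (tendsto_pow_atTop_atTop_of_one_lt one_lt_two)
  obtain ⟨L, hL, hgt⟩ :=
    ((eventually_ge_atTop 1).and (hunbounded.eventually_gt_atTop (C * T))).exists
  exact (hbounded L hL).not_gt hgt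

theorem le_abscissaOfAbsConv_walshCoeff (hβ : ∀ L, 1 ≤ L → ‖β L‖ = 1) :
    ((1 / 4 : ℝ) : EReal) ≤ LSeries.abscissaOfAbsConv (walshCoeff β) := by
  by_contra! hlt
  obtain ⟨x, hx, hx4⟩ := EReal.exists_between_coe_real hlt
  refine not_lseriesSummable_walshCoeff hβ (le_max_right x 0)
    (max_lt (EReal.coe_lt_coe_iff.1 hx4) (by norm_num))
    (LSeriesSummable_of_abscissaOfAbsConv_lt_re (hx.trans_le ?_))
  exact_mod_cast le_max_left x 0

theorem abscissaOfAbsConv_walshCoeff_le (β : ℕ → ℂ) :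
    LSeries.abscissaOfAbsConv (walshCoeff β) ≤
      abscissaOfBoundedness (walshCoeff β) + ((1 / 4 : ℝ) : EReal) :=
  abscissaOfAbsConv_le_abscissaOfBoundedness_add fun _ hn =>
    not_imp_comm.1 cardFactors_of_walshCoeff_ne_zero hn.ne'

theorem abscissaOfBoundedness_walshCoeff (hβ : ∀ L, 1 ≤ L → ‖β L‖ = 1) :
    abscissaOfBoundedness (walshCoeff β) = 0 := by
  refine le_antisymm (abscissaOfBoundedness_walshCoeff_le hβ) ?_
  have hle := EReal.sub_le_of_le_add
    ((le_abscissaOfAbsConv_walshCoeff hβ).trans (abscissaOfAbsConv_walshCoeff_le β))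
  rwa [← EReal.coe_sub, sub_self, EReal.coe_zero] at hle

theorem abscissaOfAbsConv_walshCoeff (hβ : ∀ L, 1 ≤ L → ‖β L‖ = 1) :
    LSeries.abscissaOfAbsConv (walshCoeff β) = ((1 / 4 : ℝ) : EReal) := by
  refine le_antisymm ?_ (le_abscissaOfAbsConv_walshCoeff hβ)
  simpa only [abscissaOfBoundedness_walshCoeff hβ, zero_add] using
    abscissaOfAbsConv_walshCoeff_le β

end WalshSeries

theorem mainTheorem1 :
    (∀ β : ℕ → ℂ, (∀ L : ℕ, 1 ≤ L → ‖β L‖ = 1) →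
      -- the coefficients
      (∀ L i j : ℕ, 1 ≤ L → i < 2 ^ L → j < 2 ^ L →
        walshCoeff β (blockProduct L i j) =
          β L * (((2 : ℝ) ^ (-(3 / 2 : ℝ) * (L : ℝ)) : ℝ) : ℂ) * walshEntry (2 ^ L) i j) ∧
      (∀ n : ℕ, walshCoeff β n ≠ 0 →
        ∃ L i j : ℕ, 1 ≤ L ∧ i < 2 ^ L ∧ j < 2 ^ L ∧ n = blockProduct L i j) ∧
      -- homogeneity two
      (∀ n : ℕ, walshCoeff β n ≠ 0 → Ω n = 2) ∧
      -- the abscissae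
      abscissaOfBoundedness (walshCoeff β) = 0 ∧
      ((1 / 4 : ℝ) : EReal) ≤ LSeries.abscissaOfAbsConv (walshCoeff β) ∧
      abscissaOfConv (walshCoeff β) ≤ ((-(1 / 4) : ℝ) : EReal) ∧
      -- the gaps
      LSeries.abscissaOfAbsConv (walshCoeff β) - abscissaOfBoundedness (walshCoeff β)
        = ((1 / 4 : ℝ) : EReal) ∧
      ((1 / 4 : ℝ) : EReal)
        ≤ abscissaOfBoundedness (walshCoeff β) - abscissaOfConv (walshCoeff β)) ∧
    -- optimality of the gap `1 / 4` for series of homogeneity at most two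
    (∀ a : ℕ → ℂ, (∀ n : ℕ, 2 < Ω n → a n = 0) →
      LSeries.abscissaOfAbsConv a ≤ abscissaOfBoundedness a + ((1 / 4 : ℝ) : EReal)) := by
  refine ⟨fun β hβ => ?_, fun a ha => abscissaOfAbsConv_le_abscissaOfBoundedness_add ha⟩
  have ha := abscissaOfAbsConv_walshCoeff hβ
  have hb := abscissaOfBoundedness_walshCoeff hβ
  have hc := abscissaOfConv_walshCoeff_le hβ
  refine ⟨fun L i j hL hi hj => walshCoeff_blockProduct β hL hi hj,
    fun n hn => exists_of_walshCoeff_ne_zero hn,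
    fun n hn => cardFactors_of_walshCoeff_ne_zero hn, hb, ha.ge, hc, ?_, ?_⟩
  · rw [ha, hb, sub_zero]
  · rw [hb, zero_sub, EReal.le_neg, ← EReal.coe_neg]
    exact hc
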